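/- Let $k\ge 2$ and let $a=(a(n))_{n\ge 0}$ be a synchronizing $k$-automatic sequence with values in an alphabet $\mathcal A$; that is, there is a finite deterministic automaton with output, in which every state has exactly one outgoing edge labelled $d$ for each digit $d\in\{0,1,\dots,k-1\}$, such that $a(n)$ is the output of the state reached from the initial state by reading the base-$k$ expansion of $n$, most significant digit first, and such that some word $w\in\{0,1,\dots,k-1\}^*$ leads from every state of the automaton to one and the same state. Let $(p_n)_{n\ge 0}$ be the increasing sequence of all prime numbers, and let $c>1$ be a real number that is not an integer. Then for every letter $\alpha\in\mathcal A$ the limits $$\lim_{N\to\infty}\frac1N\,\#\{0\le n<N : a(n)=\alpha\}\qquad\text{and}\qquad \lim_{N\to\infty}\frac1N\,\#\{0\le n<N : a(\lfloor p_n^c\rfloor)=\alpha\}$$ exist and are equal. -/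

import Mathlib

open Filter Topology

/-- A deterministic automaton with output: every state has `k` outgoing edges, labelled by the
digits `0, …, k-1`; there is an initial state and every state carries an output letter. -/
structure OutputAutomaton (k : ℕ) (σ : Type) (A : Type*) where
  step : σ → Fin k → σ
  start : σ
  output : σ → A

namespace OutputAutomaton

variable {k : ℕ} {σ : Type} {A : Type*}

/-- The state reached from `s` after reading the word `w` from left to right. -/
def run (M : OutputAutomaton k σ A) (s : σ) (w : List (Fin k)) : σ :=
  w.foldl M.step s

/-- `w` is a synchronizing (reset) word: it leads to one state from every starting state. -/
def IsSynchronizingWord (M : OutputAutomaton k σ A) (w : List (Fin k)) : Prop :=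
  ∃ s : σ, ∀ t : σ, M.run t w = s

end OutputAutomaton

/-- The base-`k` expansion of `n`, most significant digit first, without leading zeros
(so that the expansion of `0` is the empty word). -/
def baseExpansion (k : ℕ) (hk : 2 ≤ k) (n : ℕ) : List (Fin k) :=
  (Nat.digits k n).reverse.pmap Fin.mk
    (fun _ hd => Nat.digits_lt_base hk (List.mem_reverse.mp hd))

/-- The automaton `M` generates the sequence `a`. -/
def OutputAutomaton.Generates {k : ℕ} {σ : Type} {A : Type*} (M : OutputAutomaton k σ A)
    (hk : 2 ≤ k) (a : ℕ → A) : Prop :=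
  ∀ n : ℕ, a n = M.output (M.run M.start (baseExpansion k hk n))

/-- `a` is a synchronizing `k`-automatic sequence: it is generated by a finite automaton that has a
synchronizing word. (Restricting a synchronizing automaton to its reachable states and merging
equivalent states keeps it synchronizing, so asking this of the minimal automaton is the same.) -/
def IsSynchronizingAutomatic {A : Type*} (k : ℕ) (hk : 2 ≤ k) (a : ℕ → A) : Prop :=
  ∃ (σ : Type) (_ : Finite σ) (M : OutputAutomaton k σ A),
    M.Generates hk a ∧ ∃ w : List (Fin k), M.IsSynchronizingWord w

/-- The letter `α` has asymptotic frequency `ϑ` in the sequence `b`: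
`#{n < N : b n = α} / N → ϑ` as `N → ∞`. -/
def HasFrequency {A : Type*} (b : ℕ → A) (α : A) (ϑ : ℝ) : Prop :=
  Tendsto (fun N : ℕ => (Set.ncard {n : ℕ | n < N ∧ b n = α} : ℝ) / (N : ℝ)) atTop (𝓝 ϑ)

/-!
The number `r < k ^ L` determines the letter `a n` for all `n` that end in the base-`k` digits
of `r`, unless the expansion of `r` contains no synchronizing word, and the proportion of such `r`
tends to `0` as `L → ∞`. Hence `α` has the same frequency in `a (b n)` for every sequence `b` that
is equidistributed in the residue classes modulo each `q`.

The sequence `⌊p ^ c⌋` is of this kind by Weyl's criterion, once the sum of `e(α p ^ c)` over the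
first `N` primes is `o(N)` for `α ≠ 0`. Vaughan's identity reduces this to bilinear sums of
`e(α (dm) ^ c)`, and these to sums over intervals of integers. As `c` is not an integer, no
derivative of `x ^ c` vanishes, so that after sufficiently many Weyl differencings the second
derivative of the phase has the size for which van der Corput's test saves a power of `N`.
-/

namespace PrimePowerSums

open Real Finset
open scoped FourierTransform ComplexConjugate fwdDiff

/-! ### Exponential sums -/

lemma norm_fourierChar_sub_le (x y : ℝ) : ‖(𝐞 x : ℂ) - 𝐞 y‖ ≤ 2 * π * |x - y| := by
  have hfactor : (𝐞 x : ℂ) - 𝐞 y = 𝐞 y * (Complex.exp (Complex.I * (2 * π * (x - y) : ℝ)) - 1) := by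
    rw [mul_comm Complex.I, ← fourierChar_apply, mul_sub_one, ← Circle.coe_mul,
      ← AddChar.map_add_eq_mul, add_sub_cancel]
  rw [hfactor, norm_mul, Circle.norm_coe, one_mul]
  refine norm_exp_I_mul_ofReal_sub_one_le.trans_eq ?_
  rw [norm_eq_abs, abs_mul, abs_of_pos two_pi_pos]

lemma four_mul_abs_sub_round_le_norm_fourierChar_sub_one (x : ℝ) :
    4 * |x - round x| ≤ ‖(𝐞 x : ℂ) - 1‖ := by
  have hperiod : (𝐞 x : ℂ) = Complex.exp (Complex.I * (2 * π * (x - round x) : ℝ)) := by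
    rw [fourierChar_apply, Complex.exp_eq_exp_iff_exists_int]
    exact ⟨round x, by push_cast; ring⟩
  have hhalf : |π * (x - round x)| ≤ π / 2 := by
    rw [abs_mul, abs_of_pos pi_pos]
    nlinarith [abs_sub_round x, pi_pos]
  have hsin := mul_abs_le_abs_sin hhalf
  rw [abs_mul, abs_of_pos pi_pos, ← mul_assoc, div_mul_cancel₀ _ pi_ne_zero] at hsin
  rw [hperiod, Complex.norm_exp_I_mul_ofReal_sub_one, norm_mul, mul_assoc 2 π,
    mul_div_cancel_left₀ _ two_ne_zero, norm_two, norm_eq_abs]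
  linarith

lemma norm_sum_fourierChar_le_card {ι : Type*} (s : Finset ι) (g : ι → ℝ) :
    ‖∑ i ∈ s, (𝐞 (g i) : ℂ)‖ ≤ #s :=
  norm_sum_le_of_le s (fun _ _ ↦ (Circle.norm_coe _).le) |>.trans_eq (by simp)

lemma norm_sum_mul_le_of_partial_sums_le (w z : ℕ → ℂ) (N : ℕ) {B : ℝ}
    (hB : ∀ n ≤ N + 1, ‖∑ i ∈ range n, z i‖ ≤ B) :
    ‖∑ i ∈ range (N + 1), w i * z i‖ ≤ B * (‖w N‖ + ∑ i ∈ range N, ‖w (i + 1) - w i‖) := by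
  have hparts := sum_range_by_parts w z (N + 1)
  simp only [smul_eq_mul, Nat.add_sub_cancel] at hparts
  rw [hparts, mul_add, mul_sum _ _ B]
  refine (norm_sub_le _ _).trans (add_le_add ?_ (norm_sum_le_of_le _ fun i hi ↦ ?_))
  · rw [norm_mul, mul_comm]
    exact mul_le_mul_of_nonneg_right (hB _ le_rfl) (norm_nonneg _)
  · rw [norm_mul, mul_comm]
    exact mul_le_mul_of_nonneg_right (hB _ (by grind)) (norm_nonneg _)

lemma le_abs_sub_round {x δ : ℝ} {v : ℤ} (hx : x ∈ Set.Icc (v + δ) (v + 1 - δ)) :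
    δ ≤ |x - round x| := by
  obtain ⟨hx₁, hx₂⟩ := hx
  rcases le_or_gt (round x) v with h | h
  · have : (round x : ℝ) ≤ v := mod_cast h
    exact le_trans (by linarith) (le_abs_self _)
  · have : (v : ℝ) + 1 ≤ round x := mod_cast h
    exact le_trans (by linarith) (neg_le_abs _)

lemma fourierChar_sub_one_ne_zero {x δ : ℝ} (hδ : 0 < δ) (hx : δ ≤ |x - round x|) :
    (𝐞 x : ℂ) - 1 ≠ 0 :=
  norm_pos_iff.1 <| lt_of_lt_of_le (by linarith)
    (four_mul_abs_sub_round_le_norm_fourierChar_sub_one x)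

lemma norm_inv_fourierChar_sub_one_le {x δ : ℝ} (hδ : 0 < δ) (hx : δ ≤ |x - round x|) :
    ‖((𝐞 x : ℂ) - 1)⁻¹‖ ≤ 1 / (4 * δ) := by
  rw [norm_inv, ← one_div]
  refine one_div_le_one_div_of_le (by positivity) ?_
  linarith [four_mul_abs_sub_round_le_norm_fourierChar_sub_one x]

lemma norm_inv_fourierChar_sub_one_sub_le {x y δ : ℝ} (hδ : 0 < δ) (hx : δ ≤ |x - round x|)
    (hy : δ ≤ |y - round y|) :
    ‖((𝐞 x : ℂ) - 1)⁻¹ - ((𝐞 y : ℂ) - 1)⁻¹‖ ≤ π / (8 * δ ^ 2) * |x - y| := by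
  rw [inv_sub_inv (fourierChar_sub_one_ne_zero hδ hx) (fourierChar_sub_one_ne_zero hδ hy),
    sub_sub_sub_cancel_right, div_eq_mul_inv, mul_inv, norm_mul, norm_mul]
  calc _ ≤ 2 * π * |y - x| * (1 / (4 * δ) * (1 / (4 * δ))) := by
        gcongr
        exacts [norm_fourierChar_sub_le _ _, norm_inv_fourierChar_sub_one_le hδ hx,
          norm_inv_fourierChar_sub_one_le hδ hy]
    _ = π / (8 * δ ^ 2) * |x - y| := by
        rw [abs_sub_comm]
        field_simp
        ring

lemma fourierChar_eq_inv_mul_sub {δ x y : ℝ} (hδ : 0 < δ) (h : δ ≤ |y - x - round (y - x)|) :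
    (𝐞 x : ℂ) = ((𝐞 (y - x) : ℂ) - 1)⁻¹ * ((𝐞 y : ℂ) - 𝐞 x) := by
  have hstep : (𝐞 y : ℂ) = 𝐞 (y - x) * 𝐞 x := by
    rw [← Circle.coe_mul, ← AddChar.map_add_eq_mul, sub_add_cancel]
  rw [hstep, ← sub_one_mul, inv_mul_cancel_left₀ (fourierChar_sub_one_ne_zero hδ h)]

/-- A weak form of the Kusmin–Landau inequality, whose sharp form has `δ⁻¹` on the right. -/
lemma norm_sum_fourierChar_le_of_fwdDiff_mem_Icc {g : ℕ → ℝ} {N : ℕ} {v : ℤ} {δ : ℝ} (hδ : 0 < δ)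
    (hmem : ∀ n < N, Δ_[1] g n ∈ Set.Icc (v + δ) (v + 1 - δ))
    (hmono : ∀ n, n + 1 < N → Δ_[1] g n ≤ Δ_[1] g (n + 1)) :
    ‖∑ n ∈ range N, (𝐞 (g n) : ℂ)‖ ≤ 1 / δ ^ 2 := by
  obtain - | N := N
  · simpa using sq_nonneg δ
  set d := Δ_[1] g
  have hround : ∀ n ≤ N, δ ≤ |d n - round (d n)| := fun n hn ↦ le_abs_sub_round (hmem n (by omega))
  set C : ℕ → ℂ := fun n ↦ ((𝐞 (d n) : ℂ) - 1)⁻¹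
  -- The sum telescopes up to the slowly varying weights `C n`.
  have hterm : ∀ n ≤ N, (𝐞 (g n) : ℂ) = C n * ((𝐞 (g (n + 1)) : ℂ) - 𝐞 (g n)) :=
    fun n hn ↦ fourierChar_eq_inv_mul_sub hδ (hround n hn)
  have htelescope : ∀ n ≤ N + 1, ‖∑ i ∈ range n, ((𝐞 (g (i + 1)) : ℂ) - 𝐞 (g i))‖ ≤ 2 := by
    intro n _
    rw [sum_range_sub fun i ↦ (𝐞 (g i) : ℂ)]
    exact (norm_sub_le _ _).trans_eq
      (by rw [Circle.norm_coe, Circle.norm_coe, one_add_one_eq_two])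
  have hvariation : ∑ n ∈ range N, ‖C (n + 1) - C n‖ ≤ π / (8 * δ ^ 2) * (1 - 2 * δ) := by
    calc _ ≤ ∑ n ∈ range N, π / (8 * δ ^ 2) * (d (n + 1) - d n) := by
          refine sum_le_sum fun n hn ↦ ?_
          rw [mem_range] at hn
          rw [← abs_of_nonneg (sub_nonneg.2 (hmono n (by omega)))]
          exact norm_inv_fourierChar_sub_one_sub_le hδ (hround _ hn) (hround _ hn.le)
      _ ≤ _ := by
          rw [← mul_sum, sum_range_sub d]
          have h₀ := hmem 0 N.succ_pos
          have h₁ := hmem N N.lt_succ_self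
          exact mul_le_mul_of_nonneg_left (by linarith [h₀.1, h₁.2]) (by positivity)
  have hδ_half : δ ≤ 1 / 2 := by linarith [(hmem 0 N.succ_pos).1, (hmem 0 N.succ_pos).2]
  calc ‖∑ n ∈ range (N + 1), (𝐞 (g n) : ℂ)‖
      = ‖∑ n ∈ range (N + 1), C n * ((𝐞 (g (n + 1)) : ℂ) - 𝐞 (g n))‖ := by
        rw [sum_congr rfl fun n hn ↦ hterm n (Nat.lt_succ_iff.1 (mem_range.1 hn))]
    _ ≤ 2 * (1 / (4 * δ) + π / (8 * δ ^ 2) * (1 - 2 * δ)) := by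
        refine (norm_sum_mul_le_of_partial_sums_le _ _ N htelescope).trans ?_
        gcongr
        exact norm_inv_fourierChar_sub_one_le hδ (hround N le_rfl)
    _ = (δ / 2 + π / 4 * (1 - 2 * δ)) / δ ^ 2 := by
        field_simp
        ring
    _ ≤ 1 / δ ^ 2 := by
        gcongr
        nlinarith [pi_le_four]

lemma natCast_sub_mul_le_sub {d : ℕ → ℝ} {N : ℕ} {l : ℝ} (hd : ∀ n < N, l ≤ Δ_[1] d n) {m n : ℕ}
    (hmn : m ≤ n) (hn : n ≤ N) : ((n : ℝ) - m) * l ≤ d n - d m := by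
  induction n, hmn using Nat.le_induction with
  | base => simp
  | succ n _ ih =>
    have hstep : l ≤ d (n + 1) - d n := hd n (by omega)
    have := ih (by omega)
    push_cast
    linarith

lemma monotoneOn_of_le_fwdDiff {d : ℕ → ℝ} {N : ℕ} {l : ℝ} (hl : 0 ≤ l)
    (hd : ∀ n < N, l ≤ Δ_[1] d n) : MonotoneOn d (Set.Iic N) := fun m _ n hn hmn ↦ by
  have hmn' : (0 : ℝ) ≤ n - m := sub_nonneg.2 (Nat.cast_le.2 hmn)
  linarith [natCast_sub_mul_le_sub hd hmn hn, mul_nonneg hmn' hl]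

lemma card_le_of_mem_Icc_of_le_fwdDiff {d : ℕ → ℝ} {N : ℕ} {l x L : ℝ} (hl : 0 < l) (hL : 0 ≤ L)
    (hd : ∀ n < N, l ≤ Δ_[1] d n) {s : Finset ℕ} (hs : s ⊆ range N)
    (hx : ∀ n ∈ s, d n ∈ Set.Icc x (x + L)) : (#s : ℝ) ≤ L / l + 1 := by
  rcases s.eq_empty_or_nonempty with rfl | hne
  · simp only [card_empty, Nat.cast_zero]
    positivity
  have hmin := s.min'_mem hne
  have hmax := s.max'_mem hne
  have hle : s.min' hne ≤ s.max' hne := s.min'_le_max' hne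
  have hcard : #s ≤ s.max' hne - s.min' hne + 1 := by
    have hsub : s ⊆ Icc (s.min' hne) (s.max' hne) := fun n hn ↦
      mem_Icc.2 ⟨s.min'_le n hn, s.le_max' n hn⟩
    have := card_le_card hsub
    rw [Nat.card_Icc] at this
    omega
  have hgrowth := natCast_sub_mul_le_sub hd hle (mem_range.1 (hs hmax)).le
  have hspread : (s.max' hne - s.min' hne : ℝ) ≤ L / l := by
    rw [le_div_iff₀ hl]
    linarith [(hx _ hmin).1, (hx _ hmax).2]
  calc (#s : ℝ) ≤ (s.max' hne - s.min' hne + 1 : ℕ) := mod_cast hcard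
    _ ≤ L / l + 1 := by
      push_cast [hle]
      linarith

lemma exists_eq_Ico_of_ordConnected {s : Finset ℕ} (hs : (s : Set ℕ).OrdConnected) :
    ∃ a b, s = Ico a b := by
  rcases s.eq_empty_or_nonempty with rfl | hne
  · exact ⟨0, 0, by simp⟩
  refine ⟨s.min' hne, s.max' hne + 1, ?_⟩
  ext n
  rw [mem_Ico, Nat.lt_succ_iff]
  exact ⟨fun hn ↦ ⟨s.min'_le n hn, s.le_max' n hn⟩,
    fun hn ↦ hs.out (s.min'_mem hne) (s.max'_mem hne) hn⟩

lemma norm_sum_fourierChar_filter_mem_Icc_le {g : ℕ → ℝ} {N : ℕ} {l δ : ℝ} (hl : 0 ≤ l)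
    (hδ : 0 < δ) (hg : ∀ n < N, l ≤ Δ_[1] (Δ_[1] g) n) (v : ℤ) :
    ‖∑ n ∈ range N with v + δ ≤ Δ_[1] g n ∧ Δ_[1] g n ≤ v + 1 - δ, (𝐞 (g n) : ℂ)‖
      ≤ 1 / δ ^ 2 := by
  have hmono := monotoneOn_of_le_fwdDiff hl hg
  set G := {n ∈ range N | v + δ ≤ Δ_[1] g n ∧ Δ_[1] g n ≤ v + 1 - δ} with hG
  have hGmem : ∀ {n}, n ∈ G ↔ n < N ∧ Δ_[1] g n ∈ Set.Icc (v + δ) (v + 1 - δ) := fun {n} ↦ by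
    rw [hG, mem_filter, mem_range, Set.mem_Icc]
  obtain ⟨a, b, hab⟩ : ∃ a b, G = Ico a b := exists_eq_Ico_of_ordConnected ⟨by
    intro x hx y hy z hz
    obtain ⟨hxN, hx⟩ := hGmem.1 hx
    obtain ⟨hyN, hy⟩ := hGmem.1 hy
    have hzN : z < N := hz.2.trans_lt hyN
    exact hGmem.2 ⟨hzN, hx.1.trans (hmono hxN.le hzN.le hz.1),
      (hmono hzN.le hyN.le hz.2).trans hy.2⟩⟩
  rw [hab] at hGmem ⊢
  rw [sum_Ico_eq_sum_range]
  refine norm_sum_fourierChar_le_of_fwdDiff_mem_Icc (v := v) hδ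
    (fun n hn ↦ (hGmem.1 (mem_Ico.2 ⟨Nat.le_add_right a n, by omega⟩)).2) fun n hn ↦ ?_
  have hN := (hGmem.1 (mem_Ico.2 ⟨Nat.le_add_right a n, by omega⟩)).1
  exact hmono hN.le (Set.mem_Iic.2 hN) (Nat.le_succ _)

lemma norm_sum_fourierChar_filter_floor_le {g : ℕ → ℝ} {N : ℕ} {l δ : ℝ} (hl : 0 < l) (hδ : 0 < δ)
    (hg : ∀ n < N, l ≤ Δ_[1] (Δ_[1] g) n) (v : ℤ) :
    ‖∑ n ∈ range N with ⌊Δ_[1] g n⌋ = v, (𝐞 (g n) : ℂ)‖ ≤ 2 * (δ / l + 1) + 1 / δ ^ 2 := by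
  set F := {n ∈ range N | ⌊Δ_[1] g n⌋ = v} with hF
  have hFmem : ∀ n ∈ F, v ≤ Δ_[1] g n ∧ Δ_[1] g n < v + 1 := fun n hn ↦
    Int.floor_eq_iff.1 (mem_filter.1 hn).2
  have hFN : F ⊆ range N := filter_subset _ _
  have hnear : ∀ (P : ℕ → Prop) [DecidablePred P] (x : ℝ),
      (∀ n ∈ F, P n → Δ_[1] g n ∈ Set.Icc x (x + δ)) →
        ‖∑ n ∈ F with P n, (𝐞 (g n) : ℂ)‖ ≤ δ / l + 1 := fun P _ x hP ↦
    (norm_sum_fourierChar_le_card _ _).trans <|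
      card_le_of_mem_Icc_of_le_fwdDiff hl hδ.le hg ((filter_subset _ _).trans hFN)
        fun n hn ↦ hP n (mem_filter.1 hn).1 (mem_filter.1 hn).2
  have hbelow := hnear (fun n ↦ Δ_[1] g n < v + δ) v fun n hn hlt ↦ ⟨(hFmem n hn).1, hlt.le⟩
  have habove := hnear (fun n ↦ ¬ Δ_[1] g n < v + δ ∧ v + 1 - δ < Δ_[1] g n) (v + 1 - δ)
    fun n hn hlt ↦ ⟨hlt.2.le, by linarith [(hFmem n hn).2]⟩
  have hmiddle : ‖∑ n ∈ F with ¬ Δ_[1] g n < v + δ ∧ ¬ v + 1 - δ < Δ_[1] g n, (𝐞 (g n) : ℂ)‖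
      ≤ 1 / δ ^ 2 := by
    have hfilter : {n ∈ F | ¬ Δ_[1] g n < v + δ ∧ ¬ v + 1 - δ < Δ_[1] g n} =
        {n ∈ range N | v + δ ≤ Δ_[1] g n ∧ Δ_[1] g n ≤ v + 1 - δ} := by
      ext n
      simp only [hF, mem_filter, not_lt, Int.floor_eq_iff, and_assoc]
      exact ⟨fun h ↦ ⟨h.1, h.2.2.2⟩, fun h ↦ ⟨h.1, by linarith, by linarith, h.2⟩⟩
    rw [hfilter]
    exact norm_sum_fourierChar_filter_mem_Icc_le hl.le hδ hg v
  clear_value F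
  rw [← sum_filter_add_sum_filter_not F (fun n ↦ Δ_[1] g n < v + δ),
    ← sum_filter_add_sum_filter_not (F.filter fun n ↦ ¬ Δ_[1] g n < v + δ)
      (fun n ↦ v + 1 - δ < Δ_[1] g n), filter_filter, filter_filter]
  refine (norm_add_le_of_le hbelow (norm_add_le_of_le habove hmiddle)).trans_eq ?_
  ring

lemma norm_sum_fourierChar_le_of_fwdDiff_fwdDiff_mem_Icc' {g : ℕ → ℝ} {N : ℕ} {l u δ : ℝ}
    (hl : 0 < l) (hδ : 0 < δ) (hg : ∀ n < N, Δ_[1] (Δ_[1] g) n ∈ Set.Icc l u) :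
    ‖∑ n ∈ range N, (𝐞 (g n) : ℂ)‖ ≤ (N * u + 2) * (2 * (δ / l + 1) + 1 / δ ^ 2) := by
  set d := Δ_[1] g
  have hlower : ∀ n < N, l ≤ Δ_[1] d n := fun n hn ↦ (hg n hn).1
  have hmono : MonotoneOn d (Set.Iic N) := monotoneOn_of_le_fwdDiff hl.le hlower
  have hspread : d N - d 0 ≤ N * u := by
    have := natCast_sub_mul_le_sub (d := -d) (l := -u)
      (fun n hn ↦ by
        have : d (n + 1) - d n ≤ u := (hg n hn).2
        change -u ≤ -d (n + 1) - -d n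
        linarith) N.zero_le le_rfl
    simp only [Pi.neg_apply, Nat.cast_zero] at this
    linarith
  have hmaps : ∀ n ∈ range N, ⌊d n⌋ ∈ Icc ⌊d 0⌋ ⌊d N⌋ := fun n hn ↦ by
    have hn := (mem_range.1 hn).le
    exact mem_Icc.2 ⟨Int.floor_le_floor (hmono N.zero_le hn n.zero_le),
      Int.floor_le_floor (hmono hn Set.self_mem_Iic hn)⟩
  have hcard : (#(Icc ⌊d 0⌋ ⌊d N⌋) : ℝ) ≤ N * u + 2 := by
    have hle : ⌊d 0⌋ ≤ ⌊d N⌋ := Int.floor_le_floor (hmono N.zero_le Set.self_mem_Iic N.zero_le)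
    have : ((#(Icc ⌊d 0⌋ ⌊d N⌋) : ℤ) : ℝ) = ⌊d N⌋ + 1 - ⌊d 0⌋ := by
      rw [Int.card_Icc, Int.toNat_of_nonneg (by omega)]
      push_cast
      ring
    rw [← Int.cast_natCast, this]
    linarith [Int.floor_le (d N), Int.lt_floor_add_one (d 0)]
  rw [← sum_fiberwise_of_maps_to hmaps]
  calc _ ≤ ∑ _v ∈ Icc ⌊d 0⌋ ⌊d N⌋, (2 * (δ / l + 1) + 1 / δ ^ 2) :=
        norm_sum_le_of_le _ fun v _ ↦ norm_sum_fourierChar_filter_floor_le hl hδ hlower v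
    _ ≤ (N * u + 2) * (2 * (δ / l + 1) + 1 / δ ^ 2) := by
        rw [sum_const, nsmul_eq_mul]
        exact mul_le_mul_of_nonneg_right hcard (by positivity)

/-- A weak form of van der Corput's second derivative test, whose sharp form has `l ^ (-1 / 2)` on
the right. -/
lemma norm_sum_fourierChar_le_of_fwdDiff_fwdDiff_mem_Icc {g : ℕ → ℝ} {N : ℕ} {l u : ℝ} (hl : 0 < l)
    (hl₁ : l ≤ 1) (hu : 0 ≤ u) (hg : ∀ n < N, Δ_[1] (Δ_[1] g) n ∈ Set.Icc l u) :
    ‖∑ n ∈ range N, (𝐞 (g n) : ℂ)‖ ≤ (N * u + 2) * (5 * l ^ (-(2 / 3) : ℝ)) := by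
  have hδ : 0 < l ^ (1 / 3 : ℝ) := by positivity
  -- The choice `δ = l ^ (1 / 3)` balances `δ / l` against `1 / δ ^ 2`.
  refine (norm_sum_fourierChar_le_of_fwdDiff_fwdDiff_mem_Icc' hl hδ hg).trans ?_
  have hdiv : l ^ (1 / 3 : ℝ) / l = l ^ (-(2 / 3) : ℝ) := by
    rw [← rpow_sub_one hl.ne']
    norm_num
  have hinv : 1 / (l ^ (1 / 3 : ℝ)) ^ 2 = l ^ (-(2 / 3) : ℝ) := by
    rw [← rpow_natCast, ← rpow_mul hl.le, one_div, ← rpow_neg hl.le]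
    norm_num
  have hone : (1 : ℝ) ≤ l ^ (-(2 / 3) : ℝ) :=
    one_le_rpow_of_pos_of_le_one_of_nonpos hl hl₁ (by norm_num)
  rw [hdiv, hinv]
  gcongr
  linarith

lemma norm_sum_fourierChar_neg {ι : Type*} (s : Finset ι) (g : ι → ℝ) :
    ‖∑ i ∈ s, (𝐞 (-g i) : ℂ)‖ = ‖∑ i ∈ s, (𝐞 (g i) : ℂ)‖ := by
  simp only [AddChar.map_neg_eq_inv, Circle.coe_inv_eq_conj, ← map_sum, RCLike.norm_conj]

lemma sum_norm_sum_sq_le {ι κ : Type*} (s : Finset ι) (t : Finset κ) (u : ι → κ → ℂ) :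
    ∑ j ∈ t, ‖∑ i ∈ s, u i j‖ ^ 2 ≤ ∑ i ∈ s, ∑ i' ∈ s, ‖∑ j ∈ t, u i j * conj (u i' j)‖ := by
  have hexpand : ((∑ j ∈ t, ‖∑ i ∈ s, u i j‖ ^ 2 : ℝ) : ℂ) =
      ∑ i ∈ s, ∑ i' ∈ s, ∑ j ∈ t, u i j * conj (u i' j) := by
    push_cast
    simp only [← Complex.mul_conj', map_sum, sum_mul_sum]
    rw [sum_comm]
    exact sum_congr rfl fun i _ ↦ sum_comm
  calc ∑ j ∈ t, ‖∑ i ∈ s, u i j‖ ^ 2 = ‖((∑ j ∈ t, ‖∑ i ∈ s, u i j‖ ^ 2 : ℝ) : ℂ)‖ := by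
        rw [Complex.norm_real, norm_of_nonneg (by positivity)]
    _ ≤ ∑ i ∈ s, ∑ i' ∈ s, ‖∑ j ∈ t, u i j * conj (u i' j)‖ := by
        rw [hexpand]
        exact norm_sum_le_of_le _ fun i _ ↦ norm_sum_le _ _

/-- The finite sequence `z 0, …, z (N - 1)` delayed by `h` and extended by zero; averaging over the
delays is what drives the van der Corput inequality. -/
def delay (z : ℕ → ℂ) (N h t : ℕ) : ℂ :=
  if t ∈ Ico h (N + h) then z (t - h) else 0

lemma sum_range_ite_mem_Ico {E : Type*} [AddCommMonoid E] (F : ℕ → E) {a b T : ℕ} (hb : b ≤ T) :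
    ∑ t ∈ range T, (if t ∈ Ico a b then F (t - a) else 0) = ∑ n ∈ range (b - a), F n := by
  rw [sum_ite_mem, inter_eq_right.2 fun t ht ↦ mem_range.2 ((mem_Ico.1 ht).2.trans_le hb),
    sum_Ico_eq_sum_range]
  simp only [Nat.add_sub_cancel_left]

lemma sum_range_delay (z : ℕ → ℂ) {N H h : ℕ} (hh : h ≤ H) :
    ∑ t ∈ range (N + H), delay z N h t = ∑ n ∈ range N, z n := by
  simp only [delay]
  rw [sum_range_ite_mem_Ico z (by omega), Nat.add_sub_cancel]

lemma sum_range_delay_mul_conj_delay (z : ℕ → ℂ) {N H h r : ℕ} (hr : h + r ≤ H) :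
    ∑ t ∈ range (N + H), delay z N h t * conj (delay z N (h + r) t) =
      ∑ n ∈ range (N - r), z (n + r) * conj (z n) := by
  rw [show N - r = N + h - (h + r) by omega, ← sum_range_ite_mem_Ico _ (T := N + H) (by omega)]
  refine sum_congr rfl fun t _ ↦ ?_
  by_cases ht : t ∈ Ico (h + r) (N + h)
  · have ht' := mem_Ico.1 ht
    simp only [delay, if_pos ht, if_pos (mem_Ico.2 (by omega : h ≤ t ∧ t < N + h)),
      if_pos (mem_Ico.2 (by omega : h + r ≤ t ∧ t < N + (h + r)))]
    rw [show t - h = t - (h + r) + r by omega]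
  · simp only [delay, if_neg ht]
    rcases le_or_gt (h + r) t with hle | hlt
    · rw [if_neg (by grind), zero_mul]
    · rw [if_neg (by grind : t ∉ Ico (h + r) _), map_zero, mul_zero]

lemma norm_sum_delay_mul_conj_delay_le {z : ℕ → ℂ} (hz : ∀ n, ‖z n‖ ≤ 1) {N H : ℕ} {B : ℝ}
    (hB₀ : 0 ≤ B)
    (hB : ∀ r, 1 ≤ r → r < H → ‖∑ n ∈ range (N - r), z (n + r) * conj (z n)‖ ≤ B) {h h' : ℕ}
    (hh : h < H) (hh' : h' < H) :
    ‖∑ t ∈ range (N + H), delay z N h t * conj (delay z N h' t)‖ ≤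
      (if h = h' then (N : ℝ) else 0) + B := by
  wlog hle : h ≤ h' generalizing h h'
  · have hswap := this hh' hh (Nat.le_of_not_le hle)
    rw [← RCLike.norm_conj, map_sum] at hswap
    simpa only [map_mul, Complex.conj_conj, mul_comm, eq_comm] using hswap
  obtain ⟨r, rfl⟩ := Nat.exists_eq_add_of_le hle
  rw [sum_range_delay_mul_conj_delay z hh'.le]
  rcases Nat.eq_zero_or_pos r with rfl | hr
  · rw [if_pos (by omega)]
    have hterm : ∀ n ∈ range (N - 0), ‖z (n + 0) * conj (z n)‖ ≤ 1 := fun n _ ↦ by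
      rw [norm_mul, RCLike.norm_conj]
      exact mul_le_one₀ (hz _) (norm_nonneg _) (hz _)
    have := norm_sum_le_of_le _ hterm
    rw [sum_const, card_range, Nat.sub_zero, nsmul_one] at this
    exact this.trans (by linarith)
  · rw [if_neg (by omega), zero_add]
    exact hB r hr (by omega)

lemma norm_sum_sq_le_of_norm_correlation_le {z : ℕ → ℂ} (hz : ∀ n, ‖z n‖ ≤ 1) {N H : ℕ}
    (hH : 0 < H) {B : ℝ} (hB₀ : 0 ≤ B)
    (hB : ∀ r, 1 ≤ r → r < H → ‖∑ n ∈ range (N - r), z (n + r) * conj (z n)‖ ≤ B) :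
    ‖∑ n ∈ range N, z n‖ ^ 2 ≤ (N + H) * (N / H + B) := by
  have hsq : ∑ t ∈ range (N + H), ‖∑ h ∈ range H, delay z N h t‖ ^ 2 ≤
      H * N + (H : ℝ) ^ 2 * B := by
    refine (sum_norm_sum_sq_le _ _ _).trans ((sum_le_sum fun h hh ↦ sum_le_sum fun h' hh' ↦
      norm_sum_delay_mul_conj_delay_le hz hB₀ hB (mem_range.1 hh) (mem_range.1 hh')).trans_eq ?_)
    simp only [sum_add_distrib, sum_ite_eq, sum_const, card_range, nsmul_eq_mul, sum_ite_mem,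
      inter_self]
    ring
  have hH₀ : (0 : ℝ) < H := mod_cast hH
  refine le_of_mul_le_mul_left ?_ (pow_pos hH₀ 2)
  calc (H : ℝ) ^ 2 * ‖∑ n ∈ range N, z n‖ ^ 2
      = ‖∑ t ∈ range (N + H), ∑ h ∈ range H, delay z N h t‖ ^ 2 := by
        rw [sum_comm, sum_congr rfl fun h hh ↦ sum_range_delay z (mem_range.1 hh).le, sum_const,
          card_range, nsmul_eq_mul, norm_mul, Complex.norm_natCast, mul_pow]
    _ ≤ (∑ t ∈ range (N + H), ‖∑ h ∈ range H, delay z N h t‖) ^ 2 := by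
        gcongr
        exact norm_sum_le _ _
    _ ≤ (N + H) * ∑ t ∈ range (N + H), ‖∑ h ∈ range H, delay z N h t‖ ^ 2 := by
        simpa using sq_sum_le_card_mul_sum_sq (s := range (N + H))
          (f := fun t ↦ ‖∑ h ∈ range H, delay z N h t‖)
    _ ≤ (N + H) * (H * N + (H : ℝ) ^ 2 * B) := by gcongr
    _ = (H : ℝ) ^ 2 * ((N + H) * (N / H + B)) := by field_simp

/-! ### Exponential sums over powers of integers -/

/-- The iterated forward difference `Δ_[h₁] (⋯ (Δ_[hᵣ] f))` for a list `[h₁, …, hᵣ]` of steps. These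
are the phases produced by repeated Weyl differencing of the phase `f`. -/
def iterDiff (hs : List ℝ) (f : ℝ → ℝ) : ℝ → ℝ :=
  hs.foldr (fun h F ↦ Δ_[h] F) f

lemma hasDerivAt_iterDiff {f f' : ℝ → ℝ} {b : ℝ} (hf : ∀ x, b < x → HasDerivAt f (f' x) x)
    {hs : List ℝ} (hhs : ∀ h ∈ hs, 0 ≤ h) {x : ℝ} (hx : b < x) :
    HasDerivAt (iterDiff hs f) (iterDiff hs f' x) x := by
  induction hs generalizing x with
  | nil => exact hf x hx
  | cons h hs ih =>
    rw [List.forall_mem_cons] at hhs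
    exact ((ih hhs.2 (by linarith)).comp_add_const x h).sub (ih hhs.2 hx)

lemma exists_iterDiff_eq {f : ℕ → ℝ → ℝ} {b : ℝ}
    (hf : ∀ n x, b < x → HasDerivAt (f n) (f (n + 1) x) x) {hs : List ℝ} (hhs : ∀ h ∈ hs, 0 < h)
    {x : ℝ} (hx : b < x) :
    ∃ ξ ∈ Set.Icc x (x + hs.sum), iterDiff hs (f 0) x = hs.prod * f hs.length ξ := by
  induction hs generalizing f x with
  | nil => exact ⟨x, by simp, by simp [iterDiff]⟩
  | cons h hs ih =>
    rw [List.forall_mem_cons] at hhs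
    have hderiv : ∀ y, b < y → HasDerivAt (iterDiff hs (f 0)) (iterDiff hs (f 1) y) y := fun y ↦
      hasDerivAt_iterDiff (hf 0) fun h hh ↦ (hhs.2 h hh).le
    obtain ⟨y, hy, hslope⟩ := exists_hasDerivAt_eq_slope (iterDiff hs (f 0)) (iterDiff hs (f 1))
      (lt_add_of_pos_right x hhs.1)
      (fun z hz ↦ (hderiv z (hx.trans_le hz.1)).continuousAt.continuousWithinAt)
      (fun z hz ↦ hderiv z (hx.trans hz.1))
    obtain ⟨ξ, hξ, hval⟩ := ih (fun n ↦ hf (n + 1)) hhs.2 (hx.trans hy.1)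
    refine ⟨ξ, ⟨hy.1.le.trans hξ.1, ?_⟩, ?_⟩
    · rw [List.sum_cons]
      linarith [hξ.2, hy.2]
    · have hstep : iterDiff (h :: hs) (f 0) x = h * iterDiff hs (f 1) y := by
        rw [hslope, add_sub_cancel_left, mul_div_cancel₀ _ hhs.1.ne']
        rfl
      rw [hstep, hval, List.prod_cons, List.length_cons, mul_assoc]

lemma hasDerivAt_descPochhammer_mul_rpow (c : ℝ) (n : ℕ) {x : ℝ} (hx : 0 < x) :
    HasDerivAt (fun y ↦ (descPochhammer ℝ n).eval c * y ^ (c - n))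
      ((descPochhammer ℝ (n + 1)).eval c * x ^ (c - (n + 1 : ℕ))) x := by
  refine ((hasDerivAt_rpow_const (p := c - n) (Or.inl hx.ne')).const_mul _).congr_deriv ?_
  rw [descPochhammer_succ_eval, Nat.cast_succ, ← sub_sub, mul_assoc]

lemma eval_descPochhammer_ne_zero {c : ℝ} (hc : ∀ m : ℕ, c ≠ m) (n : ℕ) :
    (descPochhammer ℝ n).eval c ≠ 0 := by
  induction n with
  | zero => simp
  | succ n ih =>
    rw [descPochhammer_succ_eval]
    exact mul_ne_zero ih (sub_ne_zero.2 (hc n))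

lemma exists_iterDiff_rpow_eq (c : ℝ) {hs : List ℝ} (hhs : ∀ h ∈ hs, 0 < h) {x : ℝ} (hx : 0 < x) :
    ∃ ξ ∈ Set.Icc x (x + hs.sum), iterDiff hs (· ^ c) x =
      hs.prod * ((descPochhammer ℝ hs.length).eval c * ξ ^ (c - hs.length)) := by
  simpa using exists_iterDiff_eq (fun n x ↦ hasDerivAt_descPochhammer_mul_rpow c n) hhs hx

lemma rpow_mem_Icc_of_mem_Icc {t K : ℝ} (ht : t ∈ Set.Icc 1 K) (s : ℝ) :
    t ^ s ∈ Set.Icc (K ^ |s|)⁻¹ (K ^ |s|) := by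
  have ht₀ : 0 < t := by linarith [ht.1]
  have hle : t ^ |s| ≤ K ^ |s| := rpow_le_rpow ht₀.le ht.2 (abs_nonneg s)
  refine ⟨?_, (rpow_le_rpow_of_exponent_le ht.1 (le_abs_self s)).trans hle⟩
  calc (K ^ |s|)⁻¹ ≤ (t ^ |s|)⁻¹ := by gcongr
    _ = t ^ (-|s|) := (rpow_neg ht₀.le _).symm
    _ ≤ t ^ s := rpow_le_rpow_of_exponent_le ht.1 (neg_abs_le s)

lemma list_prod_le_pow_length {R : Type*} [CommSemiring R] [PartialOrder R] [IsOrderedRing R]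
    {l : List R} {B : R} (hl : ∀ x ∈ l, x ∈ Set.Icc 0 B) : l.prod ≤ B ^ l.length := by
  induction l with
  | nil => simp
  | cons x l ih =>
    rw [List.forall_mem_cons] at hl
    rw [List.prod_cons, List.length_cons, pow_succ']
    exact mul_le_mul hl.1.2 (ih hl.2) (List.prod_nonneg fun y hy ↦ (hl.2 y hy).1)
      (hl.1.1.trans hl.1.2)

lemma norm_sum_fourierChar_mul_of_abs_eq_one {ι : Type*} (s : Finset ι) (g : ι → ℝ) {σ : ℝ}
    (hσ : |σ| = 1) : ‖∑ i ∈ s, (𝐞 (σ * g i) : ℂ)‖ = ‖∑ i ∈ s, (𝐞 (g i) : ℂ)‖ := by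
  rcases eq_or_eq_neg_of_abs_eq hσ with rfl | rfl
  · simp only [one_mul]
  · simp only [neg_one_mul, norm_sum_fourierChar_neg]

/-- The range of `μ` is the one in `abs_mul_prod_mul_rpow_mem_Icc`. -/
lemma norm_sum_fourierChar_le_of_mul_fwdDiff_fwdDiff_mem_Icc {g : ℕ → ℝ} {N : ℕ}
    {M μ a b σ : ℝ} (hM : 1 ≤ M) (hNM : N ≤ M) (ha : 0 < a) (ha₁ : a ≤ 1) (hb : 0 ≤ b)
    (hσ : |σ| = 1) (hμ : μ ∈ Set.Icc (M ^ (-(6 / 5) : ℝ)) (M ^ (-(3 / 20) : ℝ)))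
    (hg : ∀ n < N, σ * Δ_[1] (Δ_[1] g) n ∈ Set.Icc (a * μ) (b * μ)) :
    ‖∑ n ∈ range N, (𝐞 (g n) : ℂ)‖ ≤
      5 * (b + 2) * a ^ (-(2 / 3) : ℝ) * M ^ (1 - 1 / 20 : ℝ) := by
  have hM₀ : 0 < M := by linarith
  have hμ₀ : 0 < μ := (rpow_pos_of_pos hM₀ _).trans_le hμ.1
  have hμ₁ : μ ≤ 1 := hμ.2.trans (rpow_le_one_of_one_le_of_nonpos hM (by norm_num))
  rw [← norm_sum_fourierChar_mul_of_abs_eq_one _ _ hσ]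
  refine (norm_sum_fourierChar_le_of_fwdDiff_fwdDiff_mem_Icc (l := a * μ) (u := b * μ)
    (by positivity) (mul_le_one₀ ha₁ hμ₀.le hμ₁) (by positivity) fun n hn ↦ ?_).trans ?_
  · have hsmul : Δ_[1] (Δ_[1] fun n ↦ σ * g n) n = σ * Δ_[1] (Δ_[1] g) n := by
      simp only [fwdDiff]
      ring
    exact hsmul ▸ hg n hn
  have hfirst : N * (μ * μ ^ (-(2 / 3) : ℝ)) ≤ M ^ (1 - 1 / 20 : ℝ) := by
    calc N * (μ * μ ^ (-(2 / 3) : ℝ)) = N * μ ^ (1 / 3 : ℝ) := by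
          rw [← rpow_one_add' hμ₀.le (by norm_num)]
          norm_num
      _ ≤ M * (M ^ (-(3 / 20) : ℝ)) ^ (1 / 3 : ℝ) := by
          gcongr
          exact hμ.2
      _ = M ^ (1 - 1 / 20 : ℝ) := by
          rw [← rpow_mul hM₀.le, ← rpow_one_add' hM₀.le (by norm_num)]
          norm_num
  have hsecond : μ ^ (-(2 / 3) : ℝ) ≤ M ^ (1 - 1 / 20 : ℝ) := by
    calc μ ^ (-(2 / 3) : ℝ) ≤ (M ^ (-(6 / 5) : ℝ)) ^ (-(2 / 3) : ℝ) :=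
          rpow_le_rpow_of_nonpos (by positivity) hμ.1 (by norm_num)
      _ = M ^ (4 / 5 : ℝ) := by
          rw [← rpow_mul hM₀.le]
          norm_num
      _ ≤ M ^ (1 - 1 / 20 : ℝ) := rpow_le_rpow_of_exponent_le hM (by norm_num)
  rw [mul_rpow ha.le hμ₀.le]
  calc (N * (b * μ) + 2) * (5 * (a ^ (-(2 / 3) : ℝ) * μ ^ (-(2 / 3) : ℝ)))
      = 5 * a ^ (-(2 / 3) : ℝ) * (b * (N * (μ * μ ^ (-(2 / 3) : ℝ))) + 2 * μ ^ (-(2 / 3) : ℝ)) := by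
        ring
    _ ≤ 5 * a ^ (-(2 / 3) : ℝ) * (b * M ^ (1 - 1 / 20 : ℝ) + 2 * M ^ (1 - 1 / 20 : ℝ)) := by
        gcongr
    _ = _ := by ring

lemma exists_fwdDiff_fwdDiff_iterDiff_rpow_eq (c β : ℝ) {hs : List ℝ} (hhs : ∀ h ∈ hs, 0 < h)
    {M a : ℝ} (hM : 0 < M) (ha : M ≤ a) (n : ℕ) :
    ∃ t, 1 ≤ t ∧ t * M ≤ a + n + (2 + hs.sum) ∧
      Δ_[1] (Δ_[1] fun n : ℕ ↦ β * iterDiff hs (· ^ c) (a + n)) n =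
        β * (descPochhammer ℝ (hs.length + 2)).eval c *
          (hs.prod * M ^ (c - (hs.length + 2)) * t ^ (c - (hs.length + 2))) := by
  have hx : M ≤ a + n := by linarith [(Nat.cast_nonneg n : (0 : ℝ) ≤ n)]
  obtain ⟨ξ, hξ, hval⟩ := exists_iterDiff_rpow_eq c (hs := 1 :: 1 :: hs) (by simpa using hhs)
    (hM.trans_le hx)
  have hξM := hx.trans hξ.1
  refine ⟨ξ / M, (one_le_div hM).2 hξM, ?_, ?_⟩
  · rw [div_mul_cancel₀ _ hM.ne']
    refine hξ.2.trans_eq ?_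
    rw [List.sum_cons, List.sum_cons]
    ring
  · have hdiff : Δ_[1] (Δ_[1] fun n : ℕ ↦ β * iterDiff hs (· ^ c) (a + n)) n =
        β * iterDiff (1 :: 1 :: hs) (· ^ c) (a + n) := by
      simp only [iterDiff, List.foldr_cons, fwdDiff, Nat.cast_add, Nat.cast_one, ← add_assoc]
      ring
    rw [hdiff, hval, mul_assoc hs.prod, ← mul_rpow hM.le (div_nonneg (hM.le.trans hξM) hM.le),
      mul_div_cancel₀ _ hM.ne']
    simp only [List.prod_cons, List.length_cons]
    push_cast
    ring_nf

lemma abs_mul_prod_mul_rpow_mem_Icc {c β M : ℝ} {j : ℕ} (hM : 1 ≤ M)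
    (hβ : |β| * M ^ c ∈ Set.Icc (M ^ (j + 4 / 5 : ℝ)) (M ^ (j + 9 / 5 : ℝ))) {hs : List ℝ}
    (hlen : hs.length = j) (hhs : ∀ h ∈ hs, h ∈ Set.Icc 1 (M ^ (1 / (20 * (j + 1)) : ℝ))) :
    |β| * (hs.prod * M ^ (c - (j + 2))) ∈
      Set.Icc (M ^ (-(6 / 5) : ℝ)) (M ^ (-(3 / 20) : ℝ)) := by
  have hM₀ : 0 < M := by linarith
  have hprod₁ : 1 ≤ hs.prod := List.one_le_prod fun h hh ↦ (hhs h hh).1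
  have hprod₂ : hs.prod ≤ M ^ (1 / 20 : ℝ) := by
    refine (list_prod_le_pow_length fun h hh ↦
      ⟨zero_le_one.trans (hhs h hh).1, (hhs h hh).2⟩).trans ?_
    rw [hlen, ← rpow_mul_natCast hM₀.le]
    refine rpow_le_rpow_of_exponent_le hM ?_
    rw [div_mul_eq_mul_div, div_le_div_iff₀ (by positivity) (by norm_num)]
    linarith
  have hsplit : |β| * (hs.prod * M ^ (c - (j + 2))) =
      |β| * M ^ c * M ^ (-(j + 2) : ℝ) * hs.prod := by
    rw [sub_eq_add_neg, rpow_add hM₀]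
    ring
  rw [hsplit]
  constructor
  · calc M ^ (-(6 / 5) : ℝ) = M ^ (j + 4 / 5 : ℝ) * M ^ (-(j + 2) : ℝ) * 1 := by
          rw [mul_one, ← rpow_add hM₀]
          ring_nf
      _ ≤ _ := by
          gcongr
          exact hβ.1
  · calc _ ≤ M ^ (j + 9 / 5 : ℝ) * M ^ (-(j + 2) : ℝ) * M ^ (1 / 20 : ℝ) := by
          gcongr
          exact hβ.2
      _ = M ^ (-(3 / 20) : ℝ) := by
          rw [← rpow_add hM₀, ← rpow_add hM₀]
          ring_nf

/-- For `β` of this size, `j` differencings by small steps bring the second differences into the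
range of the second derivative test. -/
lemma exists_norm_sum_fourierChar_iterDiff_le {c : ℝ} (hc : ∀ m : ℕ, c ≠ m) (j : ℕ) :
    ∃ C : ℝ, 0 ≤ C ∧ ∀ M β : ℝ, 1 ≤ M →
      |β| * M ^ c ∈ Set.Icc (M ^ (j + 4 / 5 : ℝ)) (M ^ (j + 9 / 5 : ℝ)) →
      ∀ hs : List ℝ, hs.length = j → (∀ h ∈ hs, h ∈ Set.Icc 1 (M ^ (1 / (20 * (j + 1)) : ℝ))) →
      ∀ (a : ℝ) (N : ℕ), M ≤ a → a + N ≤ 2 * M →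
      ‖∑ n ∈ range N, (𝐞 (β * iterDiff hs (· ^ c) (a + n)) : ℂ)‖ ≤ C * M ^ (1 - 1 / 20 : ℝ) := by
  set D := (descPochhammer ℝ (j + 2)).eval c
  have hD : D ≠ 0 := eval_descPochhammer_ne_zero hc _
  set Q := (j + 4 : ℝ) ^ |c - (j + 2)|
  have hQ : 1 ≤ Q := one_le_rpow (by linarith [(j.cast_nonneg : (0 : ℝ) ≤ j)]) (abs_nonneg _)
  have : 0 < min |D| 1 := lt_min (abs_pos.2 hD) one_pos
  refine ⟨5 * (|D| * Q + 2) * (min |D| 1 * Q⁻¹) ^ (-(2 / 3) : ℝ), by positivity, ?_⟩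
  intro M β hM hβ hs hlen hhs a N hMa haN
  have hM₀ : 0 < M := by linarith
  have hβ₀ : β ≠ 0 := fun h ↦ by
    have := (rpow_pos_of_pos hM₀ _).trans_le hβ.1
    simp [h] at this
  have hμ := abs_mul_prod_mul_rpow_mem_Icc hM hβ hlen hhs
  have hμ₀ : 0 < |β| * (hs.prod * M ^ (c - (j + 2))) := (rpow_pos_of_pos hM₀ _).trans_le hμ.1
  have hsum : hs.sum ≤ j * M := by
    have hle : M ^ (1 / (20 * (j + 1)) : ℝ) ≤ M := by
      refine rpow_le_self_of_one_le hM ?_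
      rw [div_le_one (by positivity)]
      linarith [(j.cast_nonneg : (0 : ℝ) ≤ j)]
    have := List.sum_le_card_nsmul hs M fun h hh ↦ (hhs h hh).2.trans hle
    rwa [hlen, nsmul_eq_mul] at this
  refine norm_sum_fourierChar_le_of_mul_fwdDiff_fwdDiff_mem_Icc (σ := SignType.sign (β * D))
    hM (by linarith) (by positivity) (mul_le_one₀ (min_le_right _ _) (by positivity)
      (inv_le_one_of_one_le₀ hQ)) (by positivity) ?_ hμ fun n hn ↦ ?_
  · rcases lt_or_gt_of_ne (mul_ne_zero hβ₀ hD) with h | h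
    · simp [sign_neg h]
    · simp [sign_pos h]
  obtain ⟨t, ht, htM, hval⟩ := exists_fwdDiff_fwdDiff_iterDiff_rpow_eq c β
    (fun h hh ↦ zero_lt_one.trans_le (hhs h hh).1) hM₀ hMa n
  have htK : t ≤ j + 4 := by
    have : (n : ℝ) ≤ N := mod_cast hn.le
    exact le_of_mul_le_mul_right (by linarith) hM₀
  have htQ := rpow_mem_Icc_of_mem_Icc ⟨ht, htK⟩ (c - (j + 2))
  have hsign : SignType.sign (β * D) * Δ_[1] (Δ_[1] fun n : ℕ ↦ β * iterDiff hs (· ^ c) (a + n)) n =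
      |D| * t ^ (c - (j + 2)) * (|β| * (hs.prod * M ^ (c - (j + 2)))) := by
    rw [hval, hlen, ← mul_assoc, sign_mul_self, abs_mul]
    ring
  rw [hsign]
  constructor <;> gcongr
  exacts [min_le_left _ _, htQ.1, htQ.2]

lemma norm_sum_fourierChar_le_of_norm_sum_fourierChar_sub_le {f : ℕ → ℝ} {N : ℕ} {M η δ C : ℝ}
    (hM : 1 ≤ M) (hNM : N ≤ M) (hη : η ≤ 1) (hδη : δ ≤ η) (hC : 0 ≤ C)
    (hf : ∀ r : ℕ, (r : ℝ) ∈ Set.Icc 1 (M ^ η) →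
      ‖∑ n ∈ range (N - r), (𝐞 (f (n + r) - f n) : ℂ)‖ ≤ C * M ^ (1 - δ)) :
    ‖∑ n ∈ range N, (𝐞 (f n) : ℂ)‖ ≤ √(3 * (1 + C)) * M ^ (1 - δ / 2) := by
  have hM₀ : 0 < M := by linarith
  set H := ⌈M ^ η⌉₊
  have hH : M ^ η ≤ H := Nat.le_ceil _
  have hHM : (H : ℝ) ≤ 2 * M := by
    have := Nat.ceil_lt_add_one (rpow_nonneg hM₀.le η)
    linarith [rpow_le_self_of_one_le hM hη]
  have hvdC := norm_sum_sq_le_of_norm_correlation_le (z := fun n ↦ (𝐞 (f n) : ℂ)) (N := N) (H := H)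
    (fun _ ↦ (Circle.norm_coe _).le) (Nat.ceil_pos.2 (by positivity))
    (by positivity : 0 ≤ C * M ^ (1 - δ)) fun r hr hrH ↦ by
      simpa only [← Circle.coe_inv_eq_conj, ← Circle.coe_mul, ← div_eq_mul_inv,
        ← AddChar.map_sub_eq_div] using hf r ⟨mod_cast hr, (Nat.lt_ceil.1 hrH).le⟩
  have hNH : (N : ℝ) / H ≤ M ^ (1 - δ) := by
    calc (N : ℝ) / H ≤ M / M ^ η := by gcongr
      _ = M ^ (1 - η) := by rw [rpow_sub hM₀, rpow_one]
      _ ≤ M ^ (1 - δ) := rpow_le_rpow_of_exponent_le hM (by linarith)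
  refine le_of_sq_le_sq (hvdC.trans ?_) (by positivity)
  calc ((N : ℝ) + H) * (N / H + C * M ^ (1 - δ))
      ≤ (M + 2 * M) * (M ^ (1 - δ) + C * M ^ (1 - δ)) := by gcongr
    _ = 3 * (1 + C) * (M * M ^ (1 - δ)) := by ring
    _ = (√(3 * (1 + C)) * M ^ (1 - δ / 2)) ^ 2 := by
        rw [mul_pow, sq_sqrt (by positivity), ← rpow_mul_natCast hM₀.le,
          ← rpow_one_add' hM₀.le (by linarith)]
        congr 2
        push_cast
        ring

lemma exists_norm_sum_fourierChar_iterDiff_le_of_length_add {c : ℝ} (hc : ∀ m : ℕ, c ≠ m)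
    (j i : ℕ) :
    ∃ C : ℝ, 0 ≤ C ∧ ∀ M β : ℝ, 1 ≤ M →
      |β| * M ^ c ∈ Set.Icc (M ^ (j + 4 / 5 : ℝ)) (M ^ (j + 9 / 5 : ℝ)) →
      ∀ hs : List ℝ, hs.length + i = j →
      (∀ h ∈ hs, h ∈ Set.Icc 1 (M ^ (1 / (20 * (j + 1)) : ℝ))) →
      ∀ (a : ℝ) (N : ℕ), M ≤ a → a + N ≤ 2 * M →
      ‖∑ n ∈ range N, (𝐞 (β * iterDiff hs (· ^ c) (a + n)) : ℂ)‖ ≤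
        C * M ^ (1 - 1 / (20 * (j + 1)) / 2 ^ i : ℝ) := by
  have hη : 1 / (20 * (j + 1)) ≤ (1 / 20 : ℝ) :=
    one_div_le_one_div_of_le (by norm_num) (by linarith [(j.cast_nonneg : (0 : ℝ) ≤ j)])
  induction i with
  | zero =>
    obtain ⟨C, hC, hbound⟩ := exists_norm_sum_fourierChar_iterDiff_le hc j
    refine ⟨C, hC, fun M β hM hβ hs hlen hhs a N hMa haN ↦
      (hbound M β hM hβ hs hlen hhs a N hMa haN).trans ?_⟩
    rw [pow_zero, div_one]
    gcongr
  | succ i ih =>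
    obtain ⟨C, hC, hbound⟩ := ih
    refine ⟨√(3 * (1 + C)), by positivity, fun M β hM hβ hs hlen hhs a N hMa haN ↦ ?_⟩
    rw [pow_succ, ← div_div]
    refine norm_sum_fourierChar_le_of_norm_sum_fourierChar_sub_le hM (by linarith)
      (hη.trans (by norm_num)) (div_le_self (by positivity) (one_le_pow₀ one_le_two)) hC
      fun r hr ↦ ?_
    have hdiff : ∀ n : ℕ, β * iterDiff hs (· ^ c) (a + (n + r : ℕ)) -
        β * iterDiff hs (· ^ c) (a + n) = β * iterDiff (r :: hs) (· ^ c) (a + n) := fun n ↦ by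
      rw [← mul_sub, Nat.cast_add, ← add_assoc]
      rfl
    simp only [hdiff]
    have hNr : ((N - r : ℕ) : ℝ) ≤ N := mod_cast Nat.sub_le N r
    exact hbound M β hM hβ (r :: hs) (by rw [← hlen, List.length_cons]; ring)
      (List.forall_mem_cons.2 ⟨hr, hhs⟩) a (N - r) hMa (by linarith)

lemma exists_norm_sum_fourierChar_rpow_le_of_mem_Icc {c : ℝ} (hc : ∀ m : ℕ, c ≠ m) (J : ℕ) :
    ∃ C δ : ℝ, 0 ≤ C ∧ 0 < δ ∧ δ < 1 ∧ ∀ j < J, ∀ M β : ℝ, 1 ≤ M →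
      |β| * M ^ c ∈ Set.Icc (M ^ (j + 4 / 5 : ℝ)) (M ^ (j + 9 / 5 : ℝ)) →
      ∀ (a : ℝ) (N : ℕ), M ≤ a → a + N ≤ 2 * M →
      ‖∑ n ∈ range N, (𝐞 (β * (a + n) ^ c) : ℂ)‖ ≤ C * M ^ (1 - δ) := by
  induction J with
  | zero => exact ⟨0, 1 / 2, le_rfl, by norm_num, by norm_num, fun j hj ↦ absurd hj j.not_lt_zero⟩
  | succ J ih =>
    obtain ⟨C, δ, hC, hδ, hδ₁, hbound⟩ := ih
    obtain ⟨C', _, hbound'⟩ := exists_norm_sum_fourierChar_iterDiff_le_of_length_add hc J J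
    set δ' : ℝ := 1 / (20 * (J + 1)) / 2 ^ J
    refine ⟨max C C', min δ δ', le_max_of_le_left hC, lt_min hδ (by positivity),
      (min_le_left _ _).trans_lt hδ₁, fun j hj M β hM hβ a N hMa haN ↦ ?_⟩
    rcases Nat.lt_succ_iff_lt_or_eq.1 hj with hj | rfl
    · refine (hbound j hj M β hM hβ a N hMa haN).trans ?_
      gcongr
      exacts [le_max_left _ _, min_le_left _ _]
    · refine (hbound' M β hM hβ [] (by simp) (by simp) a N hMa haN).trans ?_
      gcongr
      exacts [le_max_right _ _, min_le_right _ _]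

theorem exists_norm_sum_fourierChar_rpow_le {c : ℝ} (hc₁ : 1 < c) (hc : ∀ m : ℕ, c ≠ m) {κ : ℝ}
    (hκ : 0 < κ) (A : ℝ) :
    ∃ C δ : ℝ, 0 ≤ C ∧ 0 < δ ∧ δ < 1 ∧ ∀ M β : ℝ, 1 ≤ M → κ ≤ |β| → |β| ≤ M ^ A →
      ∀ (a : ℝ) (N : ℕ), M ≤ a → a + N ≤ 2 * M →
      ‖∑ n ∈ range N, (𝐞 (β * (a + n) ^ c) : ℂ)‖ ≤ C * M ^ (1 - δ) := by
  obtain ⟨C, δ, hC, hδ, hδ₁, hbound⟩ :=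
    exists_norm_sum_fourierChar_rpow_le_of_mem_Icc hc (⌈A + c⌉₊ + 1)
  set M₀ : ℝ := (1 / κ) ^ (1 / (c - 4 / 5))
  have hM₀ : 0 ≤ M₀ := by positivity
  refine ⟨C + M₀ + 1, δ, by positivity, hδ, hδ₁, fun M β hM hκβ hβ a N hMa haN ↦ ?_⟩
  have hMpos : 0 < M := by linarith
  rcases le_or_gt M (M₀ + 1) with hMle | hMlt
  · calc ‖∑ n ∈ range N, (𝐞 (β * (a + n) ^ c) : ℂ)‖ ≤ #(range N) := norm_sum_fourierChar_le_card _ _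
      _ ≤ (C + M₀ + 1) * 1 := by
          rw [card_range]
          linarith
      _ ≤ (C + M₀ + 1) * M ^ (1 - δ) := by
          gcongr
          exact one_le_rpow hM (by linarith)
  have hM₁ : 1 < M := by linarith
  have hlarge : M ^ (4 / 5 : ℝ) ≤ |β| * M ^ c := by
    have hpow : 1 / κ ≤ M ^ (c - 4 / 5) := by
      rw [← rpow_inv_le_iff_of_pos (by positivity) hMpos.le (by linarith), ← one_div]
      linarith
    rw [rpow_sub hMpos, div_le_div_iff₀ hκ (by positivity), one_mul] at hpow
    exact hpow.trans (by rw [mul_comm]; gcongr)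
  obtain ⟨j, hj, hj'⟩ := exists_nat_pow_near ((one_le_div (by positivity)).2 hlarge) hM₁
  rw [le_div_iff₀ (by positivity), ← rpow_natCast, ← rpow_add hMpos] at hj
  rw [div_lt_iff₀ (by positivity), ← rpow_natCast, ← rpow_add hMpos] at hj'
  have hjA : j < ⌈A + c⌉₊ + 1 := by
    have hle : M ^ (j + 4 / 5 : ℝ) ≤ M ^ (A + c) := by
      refine hj.trans ?_
      rw [rpow_add hMpos]
      gcongr
    have := (rpow_le_rpow_left_iff hM₁).1 hle
    have : (j : ℝ) ≤ ⌈A + c⌉₊ := by linarith [Nat.le_ceil (A + c)]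
    exact Nat.lt_succ_iff.2 (mod_cast this)
  refine (hbound j hjA M β hM ⟨hj, hj'.le.trans_eq ?_⟩ a N hMa haN).trans ?_
  · congr 1
    push_cast
    ring
  · gcongr
    linarith

lemma norm_sum_fourierChar_Ioc_half_le {c β C δ A : ℝ} (hδ : δ ≤ 1) (hC : 0 ≤ C)
    (hbound : ∀ M : ℝ, 1 ≤ M → |β| ≤ M ^ A → ∀ (a : ℝ) (N : ℕ), M ≤ a → a + N ≤ 2 * M →
      ‖∑ n ∈ range N, (𝐞 (β * (a + n) ^ c) : ℂ)‖ ≤ C * M ^ (1 - δ)) {y : ℕ} (hy : 0 < y)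
    (hβ : |β| ≤ ((y / 2 + 1 : ℕ) : ℝ) ^ A) :
    ‖∑ n ∈ Ioc (y / 2) y, (𝐞 (β * (n : ℝ) ^ c) : ℂ)‖ ≤ C * (y : ℝ) ^ (1 - δ) := by
  have hIoc : Ioc (y / 2) y = Ico (y / 2 + 1) (y + 1) := by
    ext n
    simp only [mem_Ioc, mem_Ico]
    omega
  rw [hIoc, sum_Ico_eq_sum_range]
  simp only [Nat.cast_add (y / 2 + 1)]
  refine (hbound _ (by simp) hβ _ _ le_rfl ?_).trans ?_
  · exact_mod_cast (by omega : y / 2 + 1 + (y + 1 - (y / 2 + 1)) ≤ 2 * (y / 2 + 1))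
  · gcongr
    omega

theorem exists_norm_sum_Ioc_fourierChar_rpow_le {c : ℝ} (hc₁ : 1 < c) (hc : ∀ m : ℕ, c ≠ m) {κ : ℝ}
    (hκ : 0 < κ) {A : ℝ} (hA : 0 < A) :
    ∃ C δ : ℝ, 0 ≤ C ∧ 0 < δ ∧ δ < 1 ∧ ∀ β B : ℝ, κ ≤ |β| → |β| ≤ B → ∀ y : ℕ,
      ‖∑ n ∈ Ioc 0 y, (𝐞 (β * (n : ℝ) ^ c) : ℂ)‖ ≤ 2 * B ^ (1 / A) + C * (y : ℝ) ^ (1 - δ) := by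
  obtain ⟨C, δ, hC, hδ, hδ₁, hbound⟩ := exists_norm_sum_fourierChar_rpow_le hc₁ hc hκ A
  set q : ℝ := (1 / 2 : ℝ) ^ (1 - δ)
  have hq : 0 < 1 - q := sub_pos.2 (rpow_lt_one (by norm_num) (by norm_num) (by linarith))
  refine ⟨C / (1 - q), δ, by positivity, hδ, hδ₁, fun β B hκβ hβB y ↦ ?_⟩
  have hB : 0 < B := by linarith
  induction y using Nat.strong_induction_on with
  | _ y ih =>
  rcases Nat.eq_zero_or_pos y with rfl | hy
  · simp only [Ioc_self, sum_empty, norm_zero]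
    positivity
  rcases lt_or_ge (((y / 2 + 1 : ℕ) : ℝ) ^ A) B with hsmall | hlarge
  · have hle : ((y / 2 + 1 : ℕ) : ℝ) ≤ B ^ (1 / A) := by
      rw [one_div, le_rpow_inv_iff_of_pos (by positivity) hB.le hA]
      exact hsmall.le
    have hcard : (y : ℝ) ≤ 2 * (y / 2 + 1 : ℕ) := mod_cast (by omega : y ≤ 2 * (y / 2 + 1))
    refine (norm_sum_fourierChar_le_card _ _).trans ?_
    rw [Nat.card_Ioc, Nat.sub_zero]
    have : 0 ≤ C / (1 - q) * (y : ℝ) ^ (1 - δ) := by positivity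
    linarith
  have hhalf : ((y / 2 : ℕ) : ℝ) ^ (1 - δ) ≤ q * (y : ℝ) ^ (1 - δ) := by
    rw [← mul_rpow (by norm_num) y.cast_nonneg, one_div_mul_eq_div]
    exact rpow_le_rpow (Nat.cast_nonneg _) Nat.cast_div_le (by linarith)
  have hupper := norm_sum_fourierChar_Ioc_half_le hδ₁.le hC (hbound · β · hκβ) hy
    (hβB.trans hlarge)
  rw [← sum_Ioc_consecutive _ (Nat.zero_le (y / 2)) (Nat.div_le_self y 2)]
  calc _ ≤ 2 * B ^ (1 / A) + C / (1 - q) * ((y / 2 : ℕ) : ℝ) ^ (1 - δ) + C * (y : ℝ) ^ (1 - δ) :=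
        norm_add_le_of_le (ih (y / 2) (by omega)) hupper
    _ ≤ 2 * B ^ (1 / A) + C / (1 - q) * (q * (y : ℝ) ^ (1 - δ)) + C * (y : ℝ) ^ (1 - δ) := by gcongr
    _ = 2 * B ^ (1 / A) + C / (1 - q) * (y : ℝ) ^ (1 - δ) := by
        field_simp
        ring

/-! ### Exponential sums over primes -/

section Primes

open ArithmeticFunction hiding log
open scoped ArithmeticFunction.Moebius ArithmeticFunction.zeta

/-- The bilinear sum `∑ f(d) g(m) F(dm)` over `d ∈ s` and `1 ≤ m ≤ N / d`, into which Vaughan's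
identity decomposes sums over primes. -/
def bilinearSum (s : Finset ℕ) (N : ℕ) (f g : ℕ → ℝ) (F : ℕ → ℂ) : ℂ :=
  ∑ d ∈ s, (f d : ℂ) * ∑ m ∈ Ioc 0 (N / d), (g m : ℂ) * F (d * m)

lemma sum_Ioc_dirichlet_mul_apply (f g : ArithmeticFunction ℝ) (F : ℕ → ℂ) (N : ℕ) :
    ∑ n ∈ Ioc 0 N, ((f * g) n : ℂ) * F n = bilinearSum (Ioc 0 N) N f g F := by
  have hconv : ∀ n ∈ Ioc 0 N, ((f * g) n : ℂ) * F n = ∑ x ∈ Ioc 0 N ×ˢ Ioc 0 N,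
      if x.1 * x.2 = n then (f x.1 : ℂ) * ((g x.2 : ℂ) * F (x.1 * x.2)) else 0 := fun n hn ↦ by
    rw [mem_Ioc] at hn
    rw [ArithmeticFunction.mul_apply,
      Nat.divisorsAntidiagonal_eq_prod_filter_of_le hn.1.ne' hn.2, ← sum_filter]
    push_cast
    rw [sum_mul]
    refine sum_congr rfl fun x hx ↦ ?_
    rw [(mem_filter.1 hx).2]
    ring
  rw [sum_congr rfl hconv, sum_comm, sum_product]
  refine sum_congr rfl fun d hd ↦ ?_
  rw [mem_Ioc] at hd
  have hfilter : (Ioc 0 N).filter (fun m ↦ d * m ∈ Ioc 0 N) = Ioc 0 (N / d) := by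
    ext m
    simp only [mem_filter, mem_Ioc, Nat.le_div_iff_mul_le hd.1, mul_comm m d]
    exact ⟨fun h ↦ ⟨h.1.1, h.2.2⟩, fun h ↦
      ⟨⟨h.1, (Nat.le_mul_of_pos_left m hd.1).trans h.2⟩, Nat.mul_pos hd.1 h.1, h.2⟩⟩
  simp only [mul_sum, sum_ite_eq]
  rw [← sum_filter, hfilter]

/-- The restriction `f · 1_{n ≤ U}` of an arithmetic function, one of the two truncations entering
Vaughan's identity. -/
def restrictLE (f : ArithmeticFunction ℝ) (U : ℕ) : ArithmeticFunction ℝ :=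
  ⟨fun n ↦ if n ≤ U then f n else 0, by simp⟩

/-- The restriction `f · 1_{n > U}` of an arithmetic function, one of the two truncations entering
Vaughan's identity. -/
def restrictGT (f : ArithmeticFunction ℝ) (U : ℕ) : ArithmeticFunction ℝ :=
  ⟨fun n ↦ if n ≤ U then 0 else f n, by simp⟩

section restrict

variable (f g : ArithmeticFunction ℝ) (U n : ℕ)

lemma restrictLE_apply : restrictLE f U n = if n ≤ U then f n else 0 := rfl

lemma restrictGT_apply : restrictGT f U n = if n ≤ U then 0 else f n := rfl

lemma restrictLE_add_restrictGT : restrictLE f U + restrictGT f U = f := by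
  ext n
  rw [ArithmeticFunction.add_apply, restrictLE_apply, restrictGT_apply]
  split_ifs <;> simp

lemma abs_restrictLE_le : |restrictLE f U n| ≤ |f n| := by
  rw [restrictLE_apply]
  split_ifs <;> simp

lemma abs_restrictGT_le : |restrictGT f U n| ≤ |f n| := by
  rw [restrictGT_apply]
  split_ifs <;> simp

variable {U n}

lemma restrictLE_mul_restrictLE_apply_eq_zero (hn : U * U < n) :
    (restrictLE f U * restrictLE g U) n = 0 := by
  rw [ArithmeticFunction.mul_apply]
  refine sum_eq_zero fun x hx ↦ ?_
  rw [Nat.mem_divisorsAntidiagonal] at hx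
  rw [restrictLE_apply, restrictLE_apply]
  split_ifs with h₁ h₂
  · have := Nat.mul_le_mul h₁ h₂
    omega
  all_goals simp

lemma restrictGT_mul_apply_eq_zero (hn : n ≤ U) : (restrictGT f U * g) n = 0 := by
  rw [ArithmeticFunction.mul_apply]
  refine sum_eq_zero fun x hx ↦ ?_
  rw [Nat.mem_divisorsAntidiagonal] at hx
  have hx₁ : x.1 ≤ n := Nat.le_of_dvd (Nat.pos_of_ne_zero hx.2) ⟨x.2, hx.1.symm⟩
  rw [restrictGT_apply, if_pos (hx₁.trans hn), zero_mul]

end restrict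

/-- Vaughan's identity, with the subtracted term moved to the left. -/
lemma vonMangoldt_add_eq (U : ℕ) :
    Λ + restrictLE (μ : ArithmeticFunction ℝ) U * restrictLE Λ U * (ζ : ArithmeticFunction ℝ) =
      restrictLE Λ U + restrictLE (μ : ArithmeticFunction ℝ) U * ArithmeticFunction.log +
      restrictGT (μ : ArithmeticFunction ℝ) U *
        (restrictGT Λ U * (ζ : ArithmeticFunction ℝ)) := by
  have hΛ := restrictLE_add_restrictGT Λ U
  have hμ := restrictLE_add_restrictGT (μ : ArithmeticFunction ℝ) U
  have hμζ : (μ : ArithmeticFunction ℝ) * (ζ : ArithmeticFunction ℝ) = 1 := coe_moebius_mul_coe_zeta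
  rw [← vonMangoldt_mul_zeta]
  set a := restrictLE Λ U
  set b := restrictGT Λ U
  rw [← hμ] at hμζ
  rw [← hΛ]
  linear_combination (-b) * hμζ

lemma abs_moebius_apply_le_one (n : ℕ) : |(μ : ArithmeticFunction ℝ) n| ≤ 1 := by
  rw [intCoe_apply]
  exact_mod_cast abs_moebius_le_one

lemma abs_zeta_apply_le_one (n : ℕ) : |(ζ : ArithmeticFunction ℝ) n| ≤ 1 := by
  rw [natCoe_apply, zeta_apply]
  split_ifs <;> simp

lemma abs_restrictLE_vonMangoldt_le (U n : ℕ) : |restrictLE Λ U n| ≤ Λ n :=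
  (abs_restrictLE_le _ _ _).trans_eq (abs_of_nonneg vonMangoldt_nonneg)

lemma abs_restrictGT_vonMangoldt_le (U n : ℕ) : |restrictGT Λ U n| ≤ Λ n :=
  (abs_restrictGT_le _ _ _).trans_eq (abs_of_nonneg vonMangoldt_nonneg)

lemma abs_mul_apply_le_log {f g : ArithmeticFunction ℝ} (hf : ∀ n, |f n| ≤ 1)
    (hg : ∀ n, |g n| ≤ Λ n) (n : ℕ) : |(f * g) n| ≤ Real.log n := by
  rw [ArithmeticFunction.mul_apply, ← vonMangoldt_sum]
  calc _ ≤ ∑ x ∈ n.divisorsAntidiagonal, |f x.1 * g x.2| := abs_sum_le_sum_abs _ _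
    _ ≤ ∑ x ∈ n.divisorsAntidiagonal, Λ x.2 := sum_le_sum fun x _ ↦ by
        rw [abs_mul]
        exact (mul_le_of_le_one_left (abs_nonneg _) (hf _)).trans (hg _)
    _ = ∑ d ∈ n.divisors, Λ d := Nat.sum_divisorsAntidiagonal' fun _ d ↦ Λ d

lemma sum_Ioc_zero_eq_sum_range {E : Type*} [AddCommMonoid E] (f : ℕ → E) (y : ℕ) :
    ∑ n ∈ Ioc 0 y, f n = ∑ n ∈ range y, f (n + 1) := by
  rw [range_eq_Ico, sum_Ico_add']
  rfl

lemma norm_sum_Ioc_mul_le_of_partial_sums_le (w : ℕ → ℝ) (z : ℕ → ℂ) (y : ℕ) {B : ℝ}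
    (hB : ∀ j ≤ y + 1, ‖∑ n ∈ Ioc 0 j, z n‖ ≤ B) :
    ‖∑ n ∈ Ioc 0 (y + 1), (w n : ℂ) * z n‖ ≤
      B * (|w (y + 1)| + ∑ n ∈ range y, |w (n + 1 + 1) - w (n + 1)|) := by
  simp only [sum_Ioc_zero_eq_sum_range] at hB ⊢
  simpa only [← Complex.ofReal_sub, Complex.norm_real, norm_eq_abs] using
    norm_sum_mul_le_of_partial_sums_le (fun n ↦ (w (n + 1) : ℂ)) (fun n ↦ z (n + 1)) y hB

lemma norm_sum_Ioc_mul_le_of_monotone {w : ℕ → ℝ} (hw : Monotone w) (hw₀ : 0 ≤ w 0) (z : ℕ → ℂ)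
    (y : ℕ) {B : ℝ} (hB : ∀ j ≤ y, ‖∑ n ∈ Ioc 0 j, z n‖ ≤ B) :
    ‖∑ n ∈ Ioc 0 y, (w n : ℂ) * z n‖ ≤ 2 * w y * B := by
  have hB₀ : 0 ≤ B := (norm_nonneg _).trans (hB 0 y.zero_le)
  have hnonneg : ∀ n, 0 ≤ w n := fun n ↦ hw₀.trans (hw n.zero_le)
  rcases y with _ | y
  · rw [Ioc_self, sum_empty, norm_zero]
    have := hnonneg 0
    positivity
  · refine (norm_sum_Ioc_mul_le_of_partial_sums_le w z y hB).trans ?_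
    simp only [abs_of_nonneg (hnonneg _), abs_of_nonneg (sub_nonneg.2 (hw (Nat.le_succ _)))]
    rw [sum_range_sub fun n ↦ w (n + 1)]
    nlinarith [mul_nonneg hB₀ (hnonneg 1)]

lemma norm_sum_Ioc_mul_le_of_antitone {w : ℕ → ℝ} (hw : Antitone w) (hw₀ : ∀ n, 0 ≤ w n)
    (z : ℕ → ℂ) (y : ℕ) {B : ℝ} (hB : ∀ j ≤ y, ‖∑ n ∈ Ioc 0 j, z n‖ ≤ B) :
    ‖∑ n ∈ Ioc 0 y, (w n : ℂ) * z n‖ ≤ w 0 * B := by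
  have hB₀ : 0 ≤ B := (norm_nonneg _).trans (hB 0 y.zero_le)
  rcases y with _ | y
  · simpa using mul_nonneg (hw₀ 0) hB₀
  · refine (norm_sum_Ioc_mul_le_of_partial_sums_le w z y hB).trans ?_
    simp only [abs_of_nonneg (hw₀ _), abs_sub_comm (w (_ + 1 + 1)),
      abs_of_nonneg (sub_nonneg.2 (hw (Nat.le_succ _)))]
    rw [sum_range_sub' fun n ↦ w (n + 1)]
    nlinarith [mul_le_mul_of_nonneg_right (hw (Nat.zero_le 1)) hB₀]

/-- `f N = O(N ^ (1 - δ))` for some `δ > 0`: the property of exponential sums which is propagated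
from integers to primes. -/
def PowerSaving (f : ℕ → ℝ) : Prop :=
  ∃ δ : ℝ, 0 < δ ∧ f =O[atTop] fun N : ℕ ↦ (N : ℝ) ^ (1 - δ)

lemma isBigO_natCast_rpow_of_le {s t : ℝ} (h : s ≤ t) :
    (fun N : ℕ ↦ (N : ℝ) ^ s) =O[atTop] fun N : ℕ ↦ (N : ℝ) ^ t := by
  refine Asymptotics.IsBigO.of_bound 1 ?_
  filter_upwards [eventually_ge_atTop 1] with N hN
  rw [one_mul, norm_of_nonneg (by positivity), norm_of_nonneg (by positivity)]
  exact rpow_le_rpow_of_exponent_le (mod_cast hN) h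

lemma powerSaving_rpow {s : ℝ} (hs : s < 1) : PowerSaving fun N ↦ (N : ℝ) ^ s :=
  ⟨1 - s, by linarith, isBigO_natCast_rpow_of_le (by linarith)⟩

lemma powerSaving_const (k : ℝ) : PowerSaving fun _ ↦ k := by
  refine ⟨1, one_pos, ?_⟩
  simp only [sub_self, rpow_zero]
  exact Asymptotics.isBigO_const_const k one_ne_zero _

namespace PowerSaving

variable {f g : ℕ → ℝ}

lemma add (hf : PowerSaving f) (hg : PowerSaving g) : PowerSaving fun N ↦ f N + g N := by
  obtain ⟨δ, hδ, hf⟩ := hf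
  obtain ⟨ε, hε, hg⟩ := hg
  exact ⟨min δ ε, lt_min hδ hε,
    (hf.trans (isBigO_natCast_rpow_of_le (by linarith [min_le_left δ ε]))).add
    (hg.trans (isBigO_natCast_rpow_of_le (by linarith [min_le_right δ ε])))⟩

lemma const_mul (hf : PowerSaving f) (k : ℝ) : PowerSaving fun N ↦ k * f N := by
  obtain ⟨δ, hδ, hf⟩ := hf
  exact ⟨δ, hδ, hf.const_mul_left k⟩

lemma log_mul (hf : PowerSaving f) : PowerSaving fun N ↦ log N * f N := by
  obtain ⟨δ, hδ, hf⟩ := hf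
  have hlog : (fun N : ℕ ↦ log N) =O[atTop] fun N : ℕ ↦ (N : ℝ) ^ (δ / 2) :=
    ((isLittleO_log_rpow_atTop (by linarith)).comp_tendsto tendsto_natCast_atTop_atTop).isBigO
  refine ⟨δ / 2, by linarith, (hlog.mul hf).trans_eventuallyEq ?_⟩
  filter_upwards [eventually_gt_atTop 0] with N hN
  rw [← rpow_add (mod_cast hN)]
  congr 1
  ring

lemma of_abs_le (hg : PowerSaving g) (h : ∀ᶠ N in atTop, |f N| ≤ g N) : PowerSaving f := by
  obtain ⟨δ, hδ, hg⟩ := hg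
  refine ⟨δ, hδ, (Asymptotics.IsBigO.of_bound 1 ?_).trans hg⟩
  filter_upwards [h] with N hN
  rw [one_mul]
  exact hN.trans (le_abs_self _)

lemma exists_forall_le (hf : PowerSaving f) :
    ∃ g, PowerSaving g ∧ ∀ N, ∀ j ≤ N, f j ≤ g N := by
  obtain ⟨δ, hδ, hf⟩ := hf
  set η := min δ (1 / 2)
  have hη : 0 < η := lt_min hδ (by norm_num)
  have hη₁ : η ≤ 1 / 2 := min_le_right _ _
  obtain ⟨C, hC, hfC⟩ := (hf.trans (isBigO_natCast_rpow_of_le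
    (by linarith [min_le_left δ (1 / 2)] : 1 - δ ≤ 1 - η))).exists_pos
  obtain ⟨n₀, hn₀⟩ := eventually_atTop.1 hfC.bound
  refine ⟨fun N ↦ C * (N : ℝ) ^ (1 - η) + ∑ j ∈ range n₀, |f j|,
    ((powerSaving_rpow (by linarith)).const_mul C).add (powerSaving_const _), fun N j hj ↦ ?_⟩
  have hsum : 0 ≤ ∑ j ∈ range n₀, |f j| := sum_nonneg fun _ _ ↦ abs_nonneg _
  rcases lt_or_ge j n₀ with hjn | hjn
  · have hle : |f j| ≤ ∑ j ∈ range n₀, |f j| :=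
      single_le_sum (f := fun j ↦ |f j|) (fun _ _ ↦ abs_nonneg _) (mem_range.2 hjn)
    have : 0 ≤ C * (N : ℝ) ^ (1 - η) := by positivity
    linarith [le_abs_self (f j)]
  · have hle := hn₀ j hjn
    rw [norm_eq_abs, norm_of_nonneg (by positivity)] at hle
    have : C * (j : ℝ) ^ (1 - η) ≤ C * (N : ℝ) ^ (1 - η) := by
      gcongr
      linarith
    linarith [le_abs_self (f j)]

end PowerSaving

/-- The function `n ↦ e(α n ^ c)`, where `e(x) = exp(2πix)`. -/
noncomputable def rpowChar (α c : ℝ) (n : ℕ) : ℂ := 𝐞 (α * (n : ℝ) ^ c)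

lemma norm_rpowChar (α c : ℝ) (n : ℕ) : ‖rpowChar α c n‖ = 1 := Circle.norm_coe _

lemma rpowChar_mul (α c : ℝ) (m n : ℕ) :
    rpowChar α c (m * n) = rpowChar (α * (m : ℝ) ^ c) c n := by
  rw [rpowChar, rpowChar, Nat.cast_mul, mul_rpow m.cast_nonneg n.cast_nonneg, mul_assoc]

lemma rpowChar_mul_conj_rpowChar (α β c : ℝ) (n : ℕ) :
    rpowChar α c n * conj (rpowChar β c n) = rpowChar (α - β) c n := by
  rw [rpowChar, rpowChar, rpowChar, ← Circle.coe_inv_eq_conj, ← AddChar.map_neg_eq_inv,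
    ← Circle.coe_mul, ← AddChar.map_add_eq_mul, ← sub_eq_add_neg, sub_mul]

lemma norm_sum_mul_rpowChar_le {α c L : ℝ} {s : Finset ℕ} {f : ℕ → ℝ} (hf : ∀ n ∈ s, |f n| ≤ L) :
    ‖∑ n ∈ s, (f n : ℂ) * rpowChar α c n‖ ≤ #s * L := by
  rw [← nsmul_eq_mul, ← sum_const]
  refine norm_sum_le_of_le _ fun n hn ↦ ?_
  rw [norm_mul, norm_rpowChar, mul_one, Complex.norm_real]
  exact hf n hn

lemma exists_norm_sum_Ico_rpowChar_le {c : ℝ} (hc₁ : 1 < c) (hc : ∀ m : ℕ, c ≠ m) {κ : ℝ}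
    (hκ : 0 < κ) (A : ℝ) :
    ∃ C δ : ℝ, 0 ≤ C ∧ 0 < δ ∧ δ < 1 ∧ ∀ (M : ℕ) (β : ℝ), 1 ≤ M → κ ≤ |β| → |β| ≤ (M : ℝ) ^ A →
      ∀ b ≤ 2 * M, ‖∑ n ∈ Ico M b, rpowChar β c n‖ ≤ C * (M : ℝ) ^ (1 - δ) := by
  obtain ⟨C, δ, hC, hδ, hδ₁, hbound⟩ := exists_norm_sum_fourierChar_rpow_le hc₁ hc hκ A
  refine ⟨C, δ, hC, hδ, hδ₁, fun M β hM hκβ hβ b hb ↦ ?_⟩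
  rw [sum_Ico_eq_sum_range]
  simp only [rpowChar, Nat.cast_add]
  exact hbound M β (mod_cast hM) hκβ hβ M (b - M) le_rfl
    (mod_cast (by omega : M + (b - M) ≤ 2 * M))

lemma sum_Ioc_inv_le_one_add_log (D : ℕ) : ∑ d ∈ Ioc 0 D, (d : ℝ)⁻¹ ≤ 1 + log D := by
  have h := harmonic_le_one_add_log D
  rw [harmonic_eq_sum_Icc] at h
  push_cast at h
  exact h

lemma natCast_div_rpow_le {δ : ℝ} (hδ : 0 ≤ δ) (hδ₁ : δ ≤ 1) {N d : ℕ} (hN : 1 ≤ N) (hd : 0 < d)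
    (hdN : (d : ℝ) ≤ (N : ℝ) ^ (2 / 3 : ℝ)) :
    ((N / d : ℕ) : ℝ) ^ (1 - δ) ≤ (N : ℝ) ^ (1 - δ / 3) * (d : ℝ)⁻¹ := by
  have hN₀ : (0 : ℝ) < N := mod_cast hN
  have hd₀ : (0 : ℝ) < d := mod_cast hd
  have hquot : (N : ℝ) ^ (1 / 3 : ℝ) ≤ N / d := by
    rw [le_div_iff₀ hd₀]
    calc (N : ℝ) ^ (1 / 3 : ℝ) * d ≤ (N : ℝ) ^ (1 / 3 : ℝ) * (N : ℝ) ^ (2 / 3 : ℝ) := by gcongr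
      _ = N := by rw [← rpow_add hN₀]; norm_num
  calc ((N / d : ℕ) : ℝ) ^ (1 - δ) ≤ (N / d : ℝ) ^ (1 - δ) :=
        rpow_le_rpow (by positivity) Nat.cast_div_le (by linarith)
    _ = (N / d : ℝ) * (N / d : ℝ) ^ (-δ) := by
        rw [sub_eq_add_neg, rpow_add (by positivity), rpow_one]
    _ ≤ (N / d : ℝ) * ((N : ℝ) ^ (1 / 3 : ℝ)) ^ (-δ) := mul_le_mul_of_nonneg_left
        (rpow_le_rpow_of_nonpos (by positivity) hquot (by linarith)) (by positivity)
    _ = (N : ℝ) ^ (1 - δ / 3) * (d : ℝ)⁻¹ := by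
        rw [← rpow_mul hN₀.le, sub_eq_add_neg 1 (δ / 3), rpow_add hN₀, rpow_one,
          show 1 / 3 * -δ = -(δ / 3) by ring]
        ring

lemma sum_add_mul_div_rpow_le {B C δ : ℝ} (hB : 0 ≤ B) (hC : 0 ≤ C) (hδ : 0 ≤ δ) (hδ₁ : δ ≤ 1)
    {N D : ℕ} (hN : 1 ≤ N) (hDN : D ≤ N) (hD : (D : ℝ) ≤ (N : ℝ) ^ (2 / 3 : ℝ)) :
    ∑ d ∈ Ioc 0 D, (B + C * ((N / d : ℕ) : ℝ) ^ (1 - δ)) ≤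
      B * (N : ℝ) ^ (2 / 3 : ℝ) + C * ((N : ℝ) ^ (1 - δ / 3) * (1 + log N)) := by
  rw [sum_add_distrib, ← mul_sum]
  gcongr
  · simp only [sum_const, Nat.card_Ioc, Nat.sub_zero, nsmul_eq_mul]
    rw [mul_comm]
    gcongr
  · refine (sum_le_sum fun d hd ↦ natCast_div_rpow_le hδ hδ₁ hN (mem_Ioc.1 hd).1
      (le_trans (mod_cast (mem_Ioc.1 hd).2) hD)).trans ?_
    rw [← mul_sum]
    gcongr
    refine (sum_Ioc_inv_le_one_add_log D).trans (add_le_add_right ?_ 1)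
    rcases D.eq_zero_or_pos with rfl | hD₀
    · simpa using log_natCast_nonneg N
    · exact log_le_log (mod_cast hD₀) (mod_cast hDN)

lemma exists_norm_sum_Ioc_rpowChar_mul_le {c : ℝ} (hc₁ : 1 < c) (hc : ∀ m : ℕ, c ≠ m) {α : ℝ}
    (hα : α ≠ 0) :
    ∃ C δ : ℝ, 0 ≤ C ∧ 0 < δ ∧ δ < 1 ∧ ∀ N d : ℕ, 0 < d → d ≤ N → ∀ j ≤ N / d,
      ‖∑ m ∈ Ioc 0 j, rpowChar α c (d * m)‖ ≤
        2 * |α| ^ (1 / (6 * c)) * (N : ℝ) ^ (1 / 6 : ℝ) + C * ((N / d : ℕ) : ℝ) ^ (1 - δ) := by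
  have hα₀ : 0 < |α| := abs_pos.2 hα
  obtain ⟨C, δ, hC, hδ, hδ₁, hbound⟩ :=
    exists_norm_sum_Ioc_fourierChar_rpow_le hc₁ hc hα₀ (A := 6 * c) (by linarith)
  refine ⟨C, δ, hC, hδ, hδ₁, fun N d hd hdN j hj ↦ ?_⟩
  have habs : |α * (d : ℝ) ^ c| = |α| * (d : ℝ) ^ c := by
    rw [abs_mul, abs_of_nonneg (by positivity : (0 : ℝ) ≤ (d : ℝ) ^ c)]
  have hlow : |α| ≤ |α * (d : ℝ) ^ c| := by
    rw [habs]
    exact le_mul_of_one_le_right hα₀.le (one_le_rpow (mod_cast hd) (by linarith))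
  have hupp : |α * (d : ℝ) ^ c| ≤ |α| * (N : ℝ) ^ c := by
    rw [habs]
    gcongr
  have hroot : (|α| * (N : ℝ) ^ c) ^ (1 / (6 * c)) =
      |α| ^ (1 / (6 * c)) * (N : ℝ) ^ (1 / 6 : ℝ) := by
    rw [mul_rpow hα₀.le (by positivity), ← rpow_mul N.cast_nonneg]
    congr 2
    field_simp
  simp only [rpowChar_mul]
  refine (hbound _ _ hlow hupp j).trans ?_
  rw [hroot, ← mul_assoc]
  gcongr

theorem exists_powerSaving_forall_norm_typeI_le {c : ℝ} (hc₁ : 1 < c) (hc : ∀ m : ℕ, c ≠ m)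
    {α : ℝ} (hα : α ≠ 0) :
    ∃ b : ℕ → ℝ, PowerSaving b ∧ ∀ (N D : ℕ) (L : ℝ) (f w : ℕ → ℝ), 1 ≤ N → D ≤ N →
      (D : ℝ) ≤ (N : ℝ) ^ (2 / 3 : ℝ) → (∀ d ≤ N, |f d| ≤ L) → (∀ d, D < d → f d = 0) →
      Monotone w → 0 ≤ w 0 →
      ‖bilinearSum (Ioc 0 N) N f w (rpowChar α c)‖ ≤ L * w N * b N := by
  obtain ⟨C, δ, hC, hδ, hδ₁, hbound⟩ := exists_norm_sum_Ioc_rpowChar_mul_le hc₁ hc hα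
  set B : ℝ := 2 * |α| ^ (1 / (6 * c))
  have : 0 ≤ B := by positivity
  refine ⟨fun N ↦ 2 * (B * (N : ℝ) ^ (5 / 6 : ℝ) +
    C * ((N : ℝ) ^ (1 - δ / 3) + log N * (N : ℝ) ^ (1 - δ / 3))), ?_, ?_⟩
  · have hsav : PowerSaving fun N ↦ (N : ℝ) ^ (1 - δ / 3) := powerSaving_rpow (by linarith)
    exact (((powerSaving_rpow (by norm_num)).const_mul B).add
      ((hsav.add hsav.log_mul).const_mul C)).const_mul 2
  intro N D L f w hN hDN hD hf hf₀ hw hw₀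
  have hN₀ : (0 : ℝ) < N := mod_cast hN
  have hL : 0 ≤ L := (abs_nonneg _).trans (hf 0 N.zero_le)
  have hwN : 0 ≤ w N := hw₀.trans (hw N.zero_le)
  have hterm : ∀ d ∈ Ioc 0 D, ‖(f d : ℂ) * ∑ m ∈ Ioc 0 (N / d), (w m : ℂ) * rpowChar α c (d * m)‖ ≤
      L * (2 * w N) * (B * (N : ℝ) ^ (1 / 6 : ℝ) + C * ((N / d : ℕ) : ℝ) ^ (1 - δ)) := by
    intro d hd
    rw [mem_Ioc] at hd
    have hdN : d ≤ N := hd.2.trans hDN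
    rw [norm_mul, Complex.norm_real, mul_assoc]
    refine mul_le_mul (hf d hdN) ((norm_sum_Ioc_mul_le_of_monotone hw hw₀ _ _
      (hbound N d hd.1 hdN)).trans ?_) (norm_nonneg _) hL
    gcongr
    exact hw (Nat.div_le_self _ _)
  have hsupp : bilinearSum (Ioc 0 N) N f w (rpowChar α c) =
      ∑ d ∈ Ioc 0 D, (f d : ℂ) * ∑ m ∈ Ioc 0 (N / d), (w m : ℂ) * rpowChar α c (d * m) := by
    refine (sum_subset (Ioc_subset_Ioc_right hDN) fun d hd hd' ↦ ?_).symm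
    rw [mem_Ioc] at hd hd'
    rw [hf₀ d (by omega), Complex.ofReal_zero, zero_mul]
  rw [hsupp]
  calc _ ≤ ∑ d ∈ Ioc 0 D, L * (2 * w N) *
          (B * (N : ℝ) ^ (1 / 6 : ℝ) + C * ((N / d : ℕ) : ℝ) ^ (1 - δ)) :=
        norm_sum_le_of_le _ hterm
    _ ≤ L * (2 * w N) * (B * (N : ℝ) ^ (1 / 6 : ℝ) * (N : ℝ) ^ (2 / 3 : ℝ) +
          C * ((N : ℝ) ^ (1 - δ / 3) * (1 + log N))) := by
        rw [← mul_sum]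
        gcongr
        exact sum_add_mul_div_rpow_le (by positivity) hC hδ.le hδ₁.le hN hDN hD
    _ = _ := by
        rw [mul_assoc B, ← rpow_add hN₀, show (1 / 6 + 2 / 3 : ℝ) = 5 / 6 by norm_num]
        ring

lemma norm_sum_mul_sum_sq_le {ι κ : Type*} (s : Finset ι) (t : Finset κ) {f : κ → ℂ}
    (hf : ∀ j ∈ t, ‖f j‖ ≤ 1) (u : ι → κ → ℂ) :
    ‖∑ j ∈ t, f j * ∑ i ∈ s, u i j‖ ^ 2 ≤
      #t * ∑ i ∈ s, ∑ i' ∈ s, ‖∑ j ∈ t, u i j * conj (u i' j)‖ := by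
  have hdrop : ‖∑ j ∈ t, f j * ∑ i ∈ s, u i j‖ ≤ ∑ j ∈ t, ‖∑ i ∈ s, u i j‖ :=
    norm_sum_le_of_le _ fun j hj ↦ by
      rw [norm_mul]
      exact mul_le_of_le_one_left (norm_nonneg _) (hf j hj)
  calc _ ≤ (∑ j ∈ t, ‖∑ i ∈ s, u i j‖) ^ 2 := by gcongr
    _ ≤ #t * ∑ j ∈ t, ‖∑ i ∈ s, u i j‖ ^ 2 := sq_sum_le_card_mul_sum_sq
    _ ≤ _ := by
        gcongr
        exact sum_norm_sum_sq_le s t u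

/-- The summand `g(m) e(α (dm) ^ c)` of a bilinear sum, cut off at `dm ≤ N`. The cut-off makes the
range of `m` independent of `d` in a dyadic block, so that the order of summation can be exchanged
after an application of the Cauchy–Schwarz inequality. -/
noncomputable def cutoffTerm (α c : ℝ) (g : ℕ → ℝ) (N m d : ℕ) : ℂ :=
  if d * m ≤ N then (g m : ℂ) * rpowChar α c (d * m) else 0

section cutoffTerm

variable (α c : ℝ) {g : ℕ → ℝ} {N M : ℕ}

lemma sum_cutoffTerm (g : ℕ → ℝ) {d : ℕ} (hM : 0 < M) (hd : M ≤ d) :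
    ∑ m ∈ Ioc 0 (N / M), cutoffTerm α c g N m d =
      ∑ m ∈ Ioc 0 (N / d), (g m : ℂ) * rpowChar α c (d * m) := by
  simp only [cutoffTerm]
  rw [← sum_filter]
  congr 1
  ext m
  simp only [mem_Ioc, mem_filter]
  rw [Nat.le_div_iff_mul_le (hM.trans_le hd), mul_comm m d, Nat.le_div_iff_mul_le hM]
  have hle : m * M ≤ d * m := (mul_comm m M).trans_le (Nat.mul_le_mul_right m hd)
  exact ⟨fun h ↦ ⟨h.1.1, h.2⟩, fun h ↦ ⟨⟨h.1, hle.trans h.2⟩, h.2⟩⟩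

lemma cutoffTerm_mul_conj_cutoffTerm (g : ℕ → ℝ) (m m' d : ℕ) :
    cutoffTerm α c g N m d * conj (cutoffTerm α c g N m' d) =
      if d * m ≤ N ∧ d * m' ≤ N then ((g m * g m' : ℝ) : ℂ) *
        rpowChar (α * ((m : ℝ) ^ c - (m' : ℝ) ^ c)) c d else 0 := by
  rw [cutoffTerm, cutoffTerm, ite_and]
  split_ifs
  · rw [mul_sub, ← rpowChar_mul_conj_rpowChar, ← rpowChar_mul, ← rpowChar_mul, mul_comm m,
      mul_comm m', map_mul, Complex.conj_ofReal]
    push_cast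
    ring
  all_goals simp

lemma norm_sum_cutoffTerm_mul_conj_cutoffTerm_le {m m' : ℕ} (hm : 0 < m) (hm' : 0 < m') {L E : ℝ}
    (hL : |g m| ≤ L) (hL' : |g m'| ≤ L)
    (hE : ∀ b ≤ 2 * M, ‖∑ d ∈ Ico M b, rpowChar (α * ((m : ℝ) ^ c - (m' : ℝ) ^ c)) c d‖ ≤ E) :
    ‖∑ d ∈ Ico M (2 * M), cutoffTerm α c g N m d * conj (cutoffTerm α c g N m' d)‖ ≤
      L ^ 2 * E := by
  have hfilter : (Ico M (2 * M)).filter (fun d ↦ d * m ≤ N ∧ d * m' ≤ N) =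
      Ico M (min (2 * M) (min (N / m + 1) (N / m' + 1))) := by
    ext d
    simp only [mem_filter, mem_Ico, lt_min_iff, Nat.lt_succ_iff, Nat.le_div_iff_mul_le hm,
      Nat.le_div_iff_mul_le hm']
    tauto
  simp only [cutoffTerm_mul_conj_cutoffTerm]
  rw [← sum_filter, hfilter, ← mul_sum, norm_mul, Complex.norm_real, norm_mul, sq]
  have hL₀ : 0 ≤ L := (abs_nonneg _).trans hL
  gcongr
  exacts [hL, hL', hE _ (min_le_left _ _)]

lemma norm_bilinearSum_Ico_sq_le (hM : 0 < M) {f : ℕ → ℝ} {L E : ℝ} (hE₀ : 0 ≤ E)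
    (hf : ∀ d, |f d| ≤ 1) (hg : ∀ m ≤ N, |g m| ≤ L)
    (hE : ∀ m ∈ Ioc 0 (N / M), ∀ m' ∈ Ioc 0 (N / M), m ≠ m' → ∀ b ≤ 2 * M,
      ‖∑ d ∈ Ico M b, rpowChar (α * ((m : ℝ) ^ c - (m' : ℝ) ^ c)) c d‖ ≤ E) :
    ‖bilinearSum (Ico M (2 * M)) N f g (rpowChar α c)‖ ^ 2 ≤
      L ^ 2 * (N * M + N ^ 2 * (E / M)) := by
  have : (0 : ℝ) < M := mod_cast hM
  set n := N / M
  have hn : (n : ℝ) ≤ N / M := Nat.cast_div_le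
  have hle : ∀ {m}, m ∈ Ioc 0 n → m ≤ N := fun hm ↦
    (mem_Ioc.1 hm).2.trans (Nat.div_le_self _ _)
  have hcorr : ∀ m ∈ Ioc 0 n, ∀ m' ∈ Ioc 0 n,
      ‖∑ d ∈ Ico M (2 * M), cutoffTerm α c g N m d * conj (cutoffTerm α c g N m' d)‖ ≤
        L ^ 2 * ((if m = m' then (M : ℝ) else 0) + E) := by
    intro m hm m' hm'
    refine norm_sum_cutoffTerm_mul_conj_cutoffTerm_le α c (mem_Ioc.1 hm).1 (mem_Ioc.1 hm').1
      (hg m (hle hm)) (hg m' (hle hm')) fun b hb ↦ ?_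
    split_ifs with heq
    · refine (norm_sum_fourierChar_le_card _ _).trans ?_
      have hcard : ((b - M : ℕ) : ℝ) ≤ M := mod_cast (by omega : b - M ≤ M)
      rw [Nat.card_Ico]
      linarith
    · rw [zero_add]
      exact hE m hm m' hm' heq b hb
  have hblock : bilinearSum (Ico M (2 * M)) N f g (rpowChar α c) =
      ∑ d ∈ Ico M (2 * M), (f d : ℂ) * ∑ m ∈ Ioc 0 n, cutoffTerm α c g N m d :=
    sum_congr rfl fun d hd ↦ by rw [sum_cutoffTerm α c g hM (mem_Ico.1 hd).1]
  rw [hblock]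
  calc _ ≤ #(Ico M (2 * M)) * ∑ m ∈ Ioc 0 n, ∑ m' ∈ Ioc 0 n,
          ‖∑ d ∈ Ico M (2 * M), cutoffTerm α c g N m d * conj (cutoffTerm α c g N m' d)‖ :=
        norm_sum_mul_sum_sq_le _ _ (fun d _ ↦ (Complex.norm_real _).trans_le (hf d)) _
    _ ≤ M * ∑ m ∈ Ioc 0 n, ∑ m' ∈ Ioc 0 n, L ^ 2 * ((if m = m' then (M : ℝ) else 0) + E) := by
        rw [Nat.card_Ico, show 2 * M - M = M by omega]
        gcongr with m hm m' hm'
        exact hcorr m hm m' hm'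
    _ = M * (L ^ 2 * (n * M + (n : ℝ) ^ 2 * E)) := by
        simp only [← mul_sum, sum_add_distrib, sum_ite_eq, sum_const, Nat.card_Ioc, Nat.sub_zero,
          nsmul_eq_mul, sum_ite_mem, inter_self]
        ring
    _ ≤ M * (L ^ 2 * (N / M * M + (N / M : ℝ) ^ 2 * E)) := by gcongr
    _ = L ^ 2 * (N * M + N ^ 2 * (E / M)) := by field_simp

end cutoffTerm

lemma one_le_abs_rpow_sub_rpow {c : ℝ} (hc : 1 ≤ c) {m n : ℕ} (h : m ≠ n) :
    1 ≤ |(m : ℝ) ^ c - (n : ℝ) ^ c| := by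
  wlog hlt : n < m generalizing m n
  · rw [abs_sub_comm]
    exact this h.symm (by omega)
  have hsucc : (n : ℝ) ^ c + 1 ≤ (n + 1 : ℝ) ^ c := by
    simpa using add_rpow_le_rpow_add n.cast_nonneg zero_le_one hc
  have hmono : (n + 1 : ℝ) ^ c ≤ (m : ℝ) ^ c :=
    rpow_le_rpow (by positivity) (mod_cast hlt) (by linarith)
  exact (by linarith : (1 : ℝ) ≤ _).trans (le_abs_self _)

lemma abs_rpow_sub_rpow_le {c : ℝ} (hc : 0 ≤ c) {m n N : ℕ} (hm : m ≤ N) (hn : n ≤ N) :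
    |(m : ℝ) ^ c - (n : ℝ) ^ c| ≤ (N : ℝ) ^ c :=
  abs_sub_le_of_nonneg_of_le (by positivity) (by gcongr) (by positivity) (by gcongr)

lemma mul_add_sq_mul_rpow_div_le {N M C δ : ℝ} (hN : 1 ≤ N) (hC : 0 ≤ C) (hδ : 0 ≤ δ) (hδ₁ : δ ≤ 1)
    (hM : N ^ (1 / 3 : ℝ) ≤ 2 * M) (hMN : M * N ^ (1 / 3 : ℝ) ≤ 2 * N) :
    N * M + N ^ 2 * (C * M ^ (1 - δ) / M) ≤ 2 * (1 + C) * N ^ (2 - δ / 3) := by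
  have hN₀ : 0 < N := by linarith
  have hX : 0 < N ^ (1 / 3 : ℝ) := by positivity
  have hM₀ : 0 < M := by linarith
  have hdiag : M ≤ N * (2 * N ^ (-(δ / 3))) := by
    calc M ≤ 2 * N / N ^ (1 / 3 : ℝ) := (le_div_iff₀ hX).2 hMN
      _ = N * (2 * N ^ (-(1 / 3) : ℝ)) := by rw [rpow_neg hN₀.le]; ring
      _ ≤ N * (2 * N ^ (-(δ / 3))) := by
          gcongr
  have hoff : M ^ (1 - δ) / M ≤ 2 * N ^ (-(δ / 3)) := by
    calc M ^ (1 - δ) / M = M ^ (-δ) := by rw [← rpow_sub_one hM₀.ne']; congr 1; ring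
      _ ≤ (N ^ (1 / 3 : ℝ) / 2) ^ (-δ) :=
          rpow_le_rpow_of_nonpos (by positivity) (by linarith) (by linarith)
      _ = 2 ^ δ * N ^ (-(δ / 3)) := by
          rw [div_rpow hX.le zero_le_two, rpow_neg zero_le_two, div_inv_eq_mul, mul_comm,
            ← rpow_mul hN₀.le]
          congr 2
          ring
      _ ≤ 2 * N ^ (-(δ / 3)) := by
          gcongr
          exact rpow_le_self_of_one_le one_le_two hδ₁
  calc N * M + N ^ 2 * (C * M ^ (1 - δ) / M)
      ≤ N * (N * (2 * N ^ (-(δ / 3)))) + N ^ 2 * (C * (2 * N ^ (-(δ / 3)))) := by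
        rw [mul_div_assoc]
        gcongr
    _ = 2 * (1 + C) * (N ^ (2 : ℝ) * N ^ (-(δ / 3))) := by
        rw [rpow_two]
        ring
    _ = 2 * (1 + C) * N ^ (2 - δ / 3) := by rw [← rpow_add hN₀, sub_eq_add_neg]

lemma rpow_one_sixth_le_of_rpow_one_third_le {N M : ℝ} (hN : 0 < N) (hN₂ : 2 ≤ N ^ (1 / 6 : ℝ))
    (hM : N ^ (1 / 3 : ℝ) ≤ 2 * M) : N ^ (1 / 6 : ℝ) ≤ M := by
  have hsq : N ^ (1 / 3 : ℝ) = N ^ (1 / 6 : ℝ) * N ^ (1 / 6 : ℝ) := by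
    rw [← rpow_add hN]
    norm_num
  nlinarith

lemma mul_rpow_le_rpow_of_rpow_one_sixth_le {a c N M : ℝ} (hc : 0 ≤ c) (hN : 0 ≤ N) (ha : a ≤ N)
    (hM : N ^ (1 / 6 : ℝ) ≤ M) : a * N ^ c ≤ M ^ (6 * (c + 1)) := by
  calc a * N ^ c ≤ N * N ^ c := by gcongr
    _ = (N ^ (1 / 6 : ℝ)) ^ (6 * (c + 1)) := by
        rw [← rpow_mul hN, ← rpow_one_add' hN (by linarith)]
        congr 1
        ring
    _ ≤ M ^ (6 * (c + 1)) := by gcongr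

lemma exists_norm_bilinearSum_Ico_le {c : ℝ} (hc₁ : 1 < c) (hc : ∀ m : ℕ, c ≠ m) {α : ℝ}
    (hα : α ≠ 0) :
    ∃ C δ : ℝ, 0 ≤ C ∧ 0 < δ ∧ ∀ᶠ N : ℕ in atTop, ∀ f g : ℕ → ℝ, (∀ d, |f d| ≤ 1) →
      (∀ m ≤ N, |g m| ≤ log N) → ∀ M : ℕ, (N : ℝ) ^ (1 / 3 : ℝ) ≤ 2 * M →
      M * (N : ℝ) ^ (1 / 3 : ℝ) ≤ 2 * N →
      ‖bilinearSum (Ico M (2 * M)) N f g (rpowChar α c)‖ ≤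
        C * (log N * (N : ℝ) ^ (1 - δ)) := by
  have hα₀ : 0 < |α| := abs_pos.2 hα
  obtain ⟨C, δ, hC, hδ, hδ₁, hbound⟩ := exists_norm_sum_Ico_rpowChar_le hc₁ hc hα₀ (6 * (c + 1))
  refine ⟨√(2 * (1 + C)), δ / 6, by positivity, by linarith, ?_⟩
  filter_upwards [eventually_ge_atTop 1, eventually_ge_atTop ⌈|α|⌉₊,
    ((tendsto_rpow_atTop (by norm_num : (0 : ℝ) < 1 / 6)).comp
      tendsto_natCast_atTop_atTop).eventually_ge_atTop 2] with N hN hNα hN₂ f g hf hg M hM hMN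
  have hN₁ : (1 : ℝ) ≤ N := mod_cast hN
  have hN₀ : (0 : ℝ) < N := by linarith
  have hMroot : (N : ℝ) ^ (1 / 6 : ℝ) ≤ M := rpow_one_sixth_le_of_rpow_one_third_le hN₀ hN₂ hM
  have hM₁ : 1 ≤ M := by exact_mod_cast (one_le_rpow hN₁ (by norm_num)).trans hMroot
  have hcoeff : |α| * (N : ℝ) ^ c ≤ (M : ℝ) ^ (6 * (c + 1)) :=
    mul_rpow_le_rpow_of_rpow_one_sixth_le (by linarith) hN₀.le (Nat.ceil_le.1 hNα) hMroot
  have hcorr : ∀ m ∈ Ioc 0 (N / M), ∀ m' ∈ Ioc 0 (N / M), m ≠ m' → ∀ b ≤ 2 * M,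
      ‖∑ d ∈ Ico M b, rpowChar (α * ((m : ℝ) ^ c - (m' : ℝ) ^ c)) c d‖ ≤
        C * (M : ℝ) ^ (1 - δ) := by
    intro m hm m' hm' hne b hb
    have hle : N / M ≤ N := Nat.div_le_self _ _
    refine hbound M _ hM₁ ?_ ?_ b hb <;> rw [abs_mul]
    · exact le_mul_of_one_le_right hα₀.le (one_le_abs_rpow_sub_rpow hc₁.le hne)
    · exact (mul_le_mul_of_nonneg_left (abs_rpow_sub_rpow_le (by linarith)
        ((mem_Ioc.1 hm).2.trans hle) ((mem_Ioc.1 hm').2.trans hle)) hα₀.le).trans hcoeff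
  have : 0 ≤ log N := log_nonneg hN₁
  refine le_of_sq_le_sq ?_ (by positivity)
  calc _ ≤ log N ^ 2 * (N * M + (N : ℝ) ^ 2 * (C * (M : ℝ) ^ (1 - δ) / M)) :=
        norm_bilinearSum_Ico_sq_le α c hM₁ (by positivity) hf hg hcorr
    _ ≤ log N ^ 2 * (2 * (1 + C) * (N : ℝ) ^ (2 - δ / 3)) := by
        gcongr
        exact mul_add_sq_mul_rpow_div_le hN₁ hC hδ.le hδ₁.le hM hMN
    _ = (√(2 * (1 + C)) * (log N * (N : ℝ) ^ (1 - δ / 6))) ^ 2 := by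
        rw [mul_pow, mul_pow, sq_sqrt (by positivity), ← rpow_mul_natCast hN₀.le]
        push_cast
        ring_nf

lemma bilinearSum_Ico_two_pow (N : ℕ) (f g : ℕ → ℝ) (F : ℕ → ℂ) (K : ℕ) :
    bilinearSum (Ico 1 (2 ^ K)) N f g F =
      ∑ i ∈ range K, bilinearSum (Ico (2 ^ i) (2 * 2 ^ i)) N f g F := by
  induction K with
  | zero => simp [bilinearSum]
  | succ K ih =>
    rw [sum_range_succ, ← ih, ← pow_succ']
    exact (sum_Ico_consecutive _ Nat.one_le_two_pow
      (Nat.pow_le_pow_right two_pos K.le_succ)).symm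

lemma bilinearSum_Ioc_eq_Ico {N K : ℕ} (hK : N < K) (f g : ℕ → ℝ) (F : ℕ → ℂ) :
    bilinearSum (Ioc 0 N) N f g F = bilinearSum (Ico 1 K) N f g F := by
  refine sum_subset (fun d hd ↦ ?_) fun d hd hd' ↦ ?_
  · rw [mem_Ioc] at hd
    rw [mem_Ico]
    omega
  · rw [mem_Ico] at hd
    rw [mem_Ioc] at hd'
    rw [Nat.div_eq_of_lt (by omega), Ioc_self, sum_empty, mul_zero]

lemma bilinearSum_Ico_eq_zero_of_le {N U M : ℕ} {f : ℕ → ℝ} (hf : ∀ d ≤ U, f d = 0)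
    (hM : 2 * M ≤ U + 1) (g : ℕ → ℝ) (F : ℕ → ℂ) : bilinearSum (Ico M (2 * M)) N f g F = 0 := by
  refine sum_eq_zero fun d hd ↦ ?_
  rw [mem_Ico] at hd
  rw [hf d (by omega), Complex.ofReal_zero, zero_mul]

lemma bilinearSum_Ico_eq_zero_of_div_le {N U M : ℕ} {g : ℕ → ℝ} (hg : ∀ m ≤ U, g m = 0)
    (hM₀ : 0 < M) (hM : N / M ≤ U) (f : ℕ → ℝ) (F : ℕ → ℂ) :
    bilinearSum (Ico M (2 * M)) N f g F = 0 := by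
  refine sum_eq_zero fun d hd ↦ ?_
  rw [sum_eq_zero, mul_zero]
  intro m hm
  rw [hg m ((mem_Ioc.1 hm).2.trans ((Nat.div_le_div_left (mem_Ico.1 hd).1 hM₀).trans hM)),
    Complex.ofReal_zero, zero_mul]

lemma natLog_two_add_one_le {N : ℕ} (hN : 1 ≤ N) :
    ((Nat.log 2 N + 1 : ℕ) : ℝ) ≤ 2 * log N + 1 := by
  have hpow : (2 : ℝ) ^ Nat.log 2 N ≤ N := mod_cast Nat.pow_log_le_self 2 (by omega)
  have hlog := log_le_log (by positivity) hpow
  rw [log_pow] at hlog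
  have hlog₂ := log_two_gt_d9
  have : (0 : ℝ) ≤ Nat.log 2 N := Nat.cast_nonneg _
  push_cast
  nlinarith

theorem exists_powerSaving_forall_norm_typeII_le {c : ℝ} (hc₁ : 1 < c) (hc : ∀ m : ℕ, c ≠ m)
    {α : ℝ} (hα : α ≠ 0) :
    ∃ b : ℕ → ℝ, PowerSaving b ∧ ∀ᶠ N : ℕ in atTop, ∀ f g : ℕ → ℝ, (∀ d, |f d| ≤ 1) →
      (∀ m ≤ N, |g m| ≤ log N) → (∀ d ≤ ⌊(N : ℝ) ^ (1 / 3 : ℝ)⌋₊, f d = 0) →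
      (∀ m ≤ ⌊(N : ℝ) ^ (1 / 3 : ℝ)⌋₊, g m = 0) →
      ‖bilinearSum (Ioc 0 N) N f g (rpowChar α c)‖ ≤ b N := by
  obtain ⟨C, δ, hC, hδ, hblock⟩ := exists_norm_bilinearSum_Ico_le hc₁ hc hα
  refine ⟨fun N ↦ C * (2 * (log N * (log N * (N : ℝ) ^ (1 - δ))) + log N * (N : ℝ) ^ (1 - δ)),
    ?_, ?_⟩
  · have hsav : PowerSaving fun N ↦ (N : ℝ) ^ (1 - δ) := powerSaving_rpow (by linarith)
    exact ((hsav.log_mul.log_mul.const_mul 2).add hsav.log_mul).const_mul C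
  filter_upwards [hblock, eventually_ge_atTop 1] with N hblock hN f g hf hg hf₀ hg₀
  set U := ⌊(N : ℝ) ^ (1 / 3 : ℝ)⌋₊
  set Y : ℝ := C * (log N * (N : ℝ) ^ (1 - δ)) with hY
  have hY₀ : 0 ≤ Y := by
    have := log_natCast_nonneg N
    positivity
  have hfloor : (N : ℝ) ^ (1 / 3 : ℝ) < U + 1 := Nat.lt_floor_add_one _
  have hU : (1 : ℝ) ≤ U := by
    rw [Nat.one_le_cast, Nat.one_le_floor_iff]
    exact one_le_rpow (mod_cast hN) (by norm_num)
  have hblocks : ∀ i, ‖bilinearSum (Ico (2 ^ i) (2 * 2 ^ i)) N f g (rpowChar α c)‖ ≤ Y := by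
    intro i
    have hM : 0 < 2 ^ i := Nat.two_pow_pos i
    set M := 2 ^ i
    rcases le_or_gt (N / M) U with hMbig | hMbig
    · rwa [bilinearSum_Ico_eq_zero_of_div_le hg₀ hM hMbig, norm_zero]
    rcases le_or_gt (2 * M) (U + 1) with hMsmall | hMsmall
    · rwa [bilinearSum_Ico_eq_zero_of_le hf₀ hMsmall, norm_zero]
    have hUM : (U : ℝ) * M ≤ N := mod_cast (Nat.le_div_iff_mul_le hM).1 hMbig.le
    have hUM' : ((U + 1 : ℕ) : ℝ) ≤ (2 * M : ℕ) := mod_cast hMsmall.le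
    push_cast at hUM'
    exact hblock f g hf hg M (by linarith) (by nlinarith [(M.cast_nonneg : (0 : ℝ) ≤ M)])
  rw [bilinearSum_Ioc_eq_Ico (Nat.lt_pow_succ_log_self one_lt_two N), bilinearSum_Ico_two_pow]
  calc _ ≤ ∑ _i ∈ range (Nat.log 2 N + 1), Y := norm_sum_le_of_le _ fun i _ ↦ hblocks i
    _ = (Nat.log 2 N + 1 : ℕ) * Y := by rw [sum_const, card_range, nsmul_eq_mul]
    _ ≤ (2 * log N + 1) * Y := by
        gcongr
        exact natLog_two_add_one_le hN
    _ = _ := by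
        rw [hY]
        ring

lemma monotone_log_natCast : Monotone fun n : ℕ ↦ log n := by
  intro m n hmn
  rcases m.eq_zero_or_pos with rfl | hm
  · simpa using log_natCast_nonneg n
  · exact log_le_log (mod_cast hm) (mod_cast hmn)

lemma bilinearSum_congr {s : Finset ℕ} {N : ℕ} {f g g' : ℕ → ℝ} (h : ∀ m, 0 < m → g m = g' m)
    (F : ℕ → ℂ) : bilinearSum s N f g F = bilinearSum s N f g' F := by
  refine sum_congr rfl fun d _ ↦ ?_
  rw [sum_congr rfl fun m hm ↦ by rw [h m (mem_Ioc.1 hm).1]]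

lemma sum_Ioc_vonMangoldt_mul_eq (U N : ℕ) (F : ℕ → ℂ) :
    ∑ n ∈ Ioc 0 N, (Λ n : ℂ) * F n =
      ∑ n ∈ Ioc 0 N, (restrictLE Λ U n : ℂ) * F n +
        bilinearSum (Ioc 0 N) N (restrictLE (μ : ArithmeticFunction ℝ) U) (fun m ↦ log m) F +
        bilinearSum (Ioc 0 N) N (restrictGT (μ : ArithmeticFunction ℝ) U)
          (restrictGT Λ U * (ζ : ArithmeticFunction ℝ) : ArithmeticFunction ℝ) F -
        bilinearSum (Ioc 0 N) N
          (restrictLE (μ : ArithmeticFunction ℝ) U * restrictLE Λ U : ArithmeticFunction ℝ)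
          (fun _ ↦ 1) F := by
  have hζ : ∀ m, 0 < m → (1 : ℝ) = (ζ : ArithmeticFunction ℝ) m := fun m hm ↦ by
    simp [hm.ne']
  have hlog : (fun m : ℕ ↦ log m) = ArithmeticFunction.log := rfl
  rw [bilinearSum_congr hζ, hlog]
  simp only [← sum_Ioc_dirichlet_mul_apply]
  rw [eq_sub_iff_add_eq]
  simp only [← sum_add_distrib, ← add_mul, ← Complex.ofReal_add, ← ArithmeticFunction.add_apply,
    vonMangoldt_add_eq]

lemma norm_sum_restrictLE_vonMangoldt_mul_rpowChar_le (α c : ℝ) {U N : ℕ} (hUN : U ≤ N) :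
    ‖∑ n ∈ Ioc 0 N, (restrictLE Λ U n : ℂ) * rpowChar α c n‖ ≤ U * log N := by
  have hsub : ∑ n ∈ Ioc 0 U, (restrictLE Λ U n : ℂ) * rpowChar α c n =
      ∑ n ∈ Ioc 0 N, (restrictLE Λ U n : ℂ) * rpowChar α c n := by
    refine sum_subset (Ioc_subset_Ioc_right hUN) fun n hn hn' ↦ ?_
    rw [mem_Ioc] at hn hn'
    rw [restrictLE_apply, if_neg (by omega), Complex.ofReal_zero, zero_mul]
  rw [← hsub]
  refine (norm_sum_mul_rpowChar_le fun n hn ↦ ?_).trans_eq (by rw [Nat.card_Ioc, Nat.sub_zero])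
  exact (abs_restrictLE_vonMangoldt_le U n).trans
    (vonMangoldt_le_log.trans (monotone_log_natCast ((mem_Ioc.1 hn).2.trans hUN)))

lemma exists_powerSaving_forall_norm_typeI_pieces_le {c : ℝ} (hc₁ : 1 < c) (hc : ∀ m : ℕ, c ≠ m)
    {α : ℝ} (hα : α ≠ 0) :
    ∃ b : ℕ → ℝ, PowerSaving b ∧ ∀ N U : ℕ, 1 ≤ N → (U : ℝ) ≤ (N : ℝ) ^ (1 / 3 : ℝ) →
      ‖bilinearSum (Ioc 0 N) N (restrictLE (μ : ArithmeticFunction ℝ) U) (fun m ↦ log m)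
        (rpowChar α c)‖ ≤ b N ∧
      ‖bilinearSum (Ioc 0 N) N
        (restrictLE (μ : ArithmeticFunction ℝ) U * restrictLE Λ U : ArithmeticFunction ℝ)
        (fun _ ↦ 1) (rpowChar α c)‖ ≤ b N := by
  obtain ⟨b, hb, hbound⟩ := exists_powerSaving_forall_norm_typeI_le hc₁ hc hα
  refine ⟨fun N ↦ log N * b N, hb.log_mul, fun N U hN hU ↦ ?_⟩
  have hN₁ : (1 : ℝ) ≤ N := mod_cast hN
  have hμ : ∀ d, |restrictLE (μ : ArithmeticFunction ℝ) U d| ≤ 1 := fun d ↦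
    (abs_restrictLE_le _ U d).trans (abs_moebius_apply_le_one d)
  have hUU : ((U * U : ℕ) : ℝ) ≤ (N : ℝ) ^ (2 / 3 : ℝ) := by
    calc ((U * U : ℕ) : ℝ) ≤ (N : ℝ) ^ (1 / 3 : ℝ) * (N : ℝ) ^ (1 / 3 : ℝ) := by
          push_cast
          gcongr
      _ = (N : ℝ) ^ (2 / 3 : ℝ) := by
          rw [← rpow_add (by linarith)]
          norm_num
  have hUUN : U * U ≤ N := by exact_mod_cast hUU.trans (rpow_le_self_of_one_le hN₁ (by norm_num))
  have hUle : U ≤ U * U := Nat.le_mul_self U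
  constructor
  · simpa only [one_mul] using hbound N U 1 _ (fun m ↦ log m) hN (hUle.trans hUUN)
      ((Nat.cast_le.2 hUle).trans hUU) (fun d _ ↦ hμ d)
      (fun d hd ↦ by rw [restrictLE_apply, if_neg hd.not_ge]) monotone_log_natCast (by simp)
  · simpa only [mul_one] using hbound N (U * U) (log N) _ (fun _ ↦ 1) hN hUUN hUU
      (fun d hd ↦ (abs_mul_apply_le_log hμ (abs_restrictLE_vonMangoldt_le U) d).trans
        (monotone_log_natCast hd))
      (fun d hd ↦ restrictLE_mul_restrictLE_apply_eq_zero _ _ hd) monotone_const zero_le_one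

theorem powerSaving_sum_vonMangoldt_mul_rpowChar {c : ℝ} (hc₁ : 1 < c) (hc : ∀ m : ℕ, c ≠ m)
    {α : ℝ} (hα : α ≠ 0) :
    PowerSaving fun N ↦ ‖∑ n ∈ Ioc 0 N, (Λ n : ℂ) * rpowChar α c n‖ := by
  obtain ⟨b₁, hb₁, hI⟩ := exists_powerSaving_forall_norm_typeI_pieces_le hc₁ hc hα
  obtain ⟨b₂, hb₂, hII⟩ := exists_powerSaving_forall_norm_typeII_le hc₁ hc hα
  refine ((((powerSaving_rpow (by norm_num : (1 / 3 : ℝ) < 1)).log_mul.add hb₁).add hb₂).add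
    hb₁).of_abs_le ?_
  filter_upwards [hII, eventually_ge_atTop 1] with N hII hN
  set U := ⌊(N : ℝ) ^ (1 / 3 : ℝ)⌋₊
  have hU : (U : ℝ) ≤ (N : ℝ) ^ (1 / 3 : ℝ) := Nat.floor_le (by positivity)
  have hUN : U ≤ N := by
    exact_mod_cast hU.trans (rpow_le_self_of_one_le (mod_cast hN) (by norm_num))
  obtain ⟨hI₁, hI₂⟩ := hI N U hN hU
  have hsmall : ‖∑ n ∈ Ioc 0 N, (restrictLE Λ U n : ℂ) * rpowChar α c n‖ ≤
      log N * (N : ℝ) ^ (1 / 3 : ℝ) := by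
    rw [mul_comm]
    exact (norm_sum_restrictLE_vonMangoldt_mul_rpowChar_le α c hUN).trans
      (mul_le_mul_of_nonneg_right hU (log_natCast_nonneg N))
  have hII := hII (restrictGT (μ : ArithmeticFunction ℝ) U)
    (restrictGT Λ U * (ζ : ArithmeticFunction ℝ) : ArithmeticFunction ℝ)
    (fun d ↦ (abs_restrictGT_le _ U d).trans (abs_moebius_apply_le_one d))
    (fun m hm ↦ by
      rw [mul_comm]
      exact (abs_mul_apply_le_log abs_zeta_apply_le_one (abs_restrictGT_vonMangoldt_le U) m).trans
        (monotone_log_natCast hm))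
    (fun d hd ↦ by rw [restrictGT_apply, if_pos hd])
    (fun m hm ↦ restrictGT_mul_apply_eq_zero _ _ hm)
  rw [abs_norm, sum_Ioc_vonMangoldt_mul_eq U]
  exact norm_sub_le_of_le (norm_add_le_of_le (norm_add_le_of_le hsmall hI₁) hII) hI₂

lemma norm_sum_not_prime_vonMangoldt_mul_rpowChar_le (α c : ℝ) {N : ℕ} (hN : 1 ≤ N) :
    ‖∑ n ∈ Ioc 0 N with ¬ n.Prime, (Λ n : ℂ) * rpowChar α c n‖ ≤
      2 * (log N * (N : ℝ) ^ (1 / 2 : ℝ)) := by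
  have hle := Chebyshev.psi_sub_theta_le (mod_cast hN : (1 : ℝ) ≤ N)
  rw [Chebyshev.psi_sub_theta_eq_sum_not_prime, Nat.floor_natCast] at hle
  calc _ ≤ ∑ n ∈ Ioc 0 N with ¬ n.Prime, Λ n := norm_sum_le_of_le _ fun n _ ↦ by
        rw [norm_mul, norm_rpowChar, mul_one, Complex.norm_real, norm_of_nonneg vonMangoldt_nonneg]
    _ ≤ 2 * √N * log N := hle
    _ = 2 * (log N * (N : ℝ) ^ (1 / 2 : ℝ)) := by
        rw [sqrt_eq_rpow]
        ring

lemma powerSaving_sum_log_prime_mul_rpowChar {c : ℝ} (hc₁ : 1 < c) (hc : ∀ m : ℕ, c ≠ m) {α : ℝ}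
    (hα : α ≠ 0) :
    PowerSaving fun N ↦
      ‖∑ n ∈ Ioc 0 N, if n.Prime then (log n : ℂ) * rpowChar α c n else 0‖ := by
  refine ((powerSaving_sum_vonMangoldt_mul_rpowChar hc₁ hc hα).add
    ((powerSaving_rpow (by norm_num : (1 / 2 : ℝ) < 1)).log_mul.const_mul 2)).of_abs_le ?_
  filter_upwards [eventually_ge_atTop 1] with N hN
  have hsplit : ∑ n ∈ Ioc 0 N, (if n.Prime then (log n : ℂ) * rpowChar α c n else 0) =
      ∑ n ∈ Ioc 0 N, (Λ n : ℂ) * rpowChar α c n -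
        ∑ n ∈ Ioc 0 N with ¬ n.Prime, (Λ n : ℂ) * rpowChar α c n := by
    rw [← sum_filter, eq_sub_iff_add_eq, ← sum_filter_add_sum_filter_not (Ioc 0 N) Nat.Prime
      fun n ↦ (Λ n : ℂ) * rpowChar α c n]
    congr 1
    refine sum_congr rfl fun p hp ↦ ?_
    rw [vonMangoldt_apply_prime (mem_filter.1 hp).2]
  rw [abs_norm, hsplit]
  exact norm_sub_le_of_le le_rfl (norm_sum_not_prime_vonMangoldt_mul_rpowChar_le α c hN)

theorem powerSaving_sum_prime_rpowChar {c : ℝ} (hc₁ : 1 < c) (hc : ∀ m : ℕ, c ≠ m) {α : ℝ}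
    (hα : α ≠ 0) :
    PowerSaving fun N ↦ ‖∑ p ∈ Ioc 0 N with p.Prime, rpowChar α c p‖ := by
  obtain ⟨g, hg, hle⟩ := (powerSaving_sum_log_prime_mul_rpowChar hc₁ hc hα).exists_forall_le
  -- The weight agrees with `1 / log p` at primes and is antitone on all of `ℕ`.
  set w : ℕ → ℝ := fun n ↦ (log (max n 2 : ℕ))⁻¹
  have hlog : ∀ n : ℕ, 0 < log (max n 2 : ℕ) := fun n ↦ log_pos (mod_cast by omega)
  have hw : Antitone w := fun m n hmn ↦
    inv_anti₀ (hlog m) (monotone_log_natCast (max_le_max_right 2 hmn))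
  have hw_mul : ∀ p : ℕ, p.Prime → (w p : ℂ) * (log p : ℂ) = 1 := fun p hp ↦ by
    have hlog := (hlog p).ne'
    simp only [w]
    rw [max_eq_left hp.two_le] at hlog ⊢
    rw [← Complex.ofReal_mul, inv_mul_cancel₀ hlog, Complex.ofReal_one]
  refine (hg.const_mul (w 0)).of_abs_le (.of_forall fun N ↦ ?_)
  have hsum : ∑ p ∈ Ioc 0 N with p.Prime, rpowChar α c p =
      ∑ n ∈ Ioc 0 N, (w n : ℂ) * if n.Prime then (log n : ℂ) * rpowChar α c n else 0 := by
    rw [sum_filter]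
    refine sum_congr rfl fun p _ ↦ ?_
    split_ifs with hp
    · rw [← mul_assoc, hw_mul p hp, one_mul]
    · rw [mul_zero]
  rw [abs_norm, hsum]
  exact norm_sum_Ioc_mul_le_of_antitone hw (fun n ↦ (inv_pos.2 (hlog n)).le) _ N (hle N)

end Primes

lemma sum_range_count_nth {E : Type*} [AddCommMonoid E] (p : ℕ → Prop) [DecidablePred p]
    (F : ℕ → E) (x : ℕ) :
    ∑ n ∈ range (Nat.count p x), F (Nat.nth p n) = ∑ m ∈ range x with p m, F m := by
  induction x with
  | zero => simp
  | succ x ih =>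
    rw [Nat.count_succ, sum_filter, sum_range_succ, ← sum_filter, ← ih]
    split_ifs with hp
    · rw [sum_range_succ, Nat.nth_count hp]
    · rw [add_zero, add_zero]

lemma sum_range_primeCounting_nth {E : Type*} [AddCommMonoid E] (F : ℕ → E) (x : ℕ) :
    ∑ n ∈ range (Nat.primeCounting x), F (Nat.nth Nat.Prime n) =
      ∑ p ∈ Ioc 0 x with p.Prime, F p := by
  rw [Nat.primeCounting, Nat.primeCounting', sum_range_count_nth]
  congr 1
  ext p
  simp only [mem_filter, mem_range, mem_Ioc, Nat.lt_succ_iff]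
  exact ⟨fun ⟨hx, hp⟩ ↦ ⟨⟨hp.pos, hx⟩, hp⟩, fun ⟨⟨_, hx⟩, hp⟩ ↦ ⟨hx, hp⟩⟩

lemma eventually_le_two_mul_primeCounting_mul_log :
    ∀ᶠ x : ℕ in atTop, (x : ℝ) ≤ 2 * (Nat.primeCounting x * log x) := by
  have hsmall : ∀ᶠ x : ℕ in atTop, ‖log x‖ ≤ 1 / 100 * ‖(x : ℝ)‖ :=
    (isLittleO_log_id_atTop.comp_tendsto tendsto_natCast_atTop_atTop).bound (by norm_num)
  filter_upwards [hsmall, eventually_ge_atTop 100] with x hx hx₁₀₀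
  rw [norm_natCast, norm_of_nonneg (log_natCast_nonneg x)] at hx
  have hx₁ : (100 : ℝ) ≤ x := mod_cast hx₁₀₀
  have hsucc : log (x + 1) ≤ log x + log 2 := by
    rw [← log_mul (by linarith) two_ne_zero]
    exact log_le_log (by linarith) (by linarith)
  have hψ := (Chebyshev.psi_ge x).trans (Chebyshev.psi_le_primeCounting_mul_log x)
  have hlog₂ := log_two_gt_d9
  have hlog₂' := log_two_lt_d9
  nlinarith

namespace PowerSaving

variable {f : ℕ → ℝ}

lemma tendsto_div_natCast (hf : PowerSaving f) :
    Tendsto (fun x ↦ f x / (x : ℝ)) atTop (𝓝 0) := by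
  obtain ⟨δ, hδ, hf⟩ := hf
  refine (hf.mul (Asymptotics.isBigO_refl (fun x : ℕ ↦ (x : ℝ)⁻¹) atTop)).trans_tendsto ?_
  refine ((tendsto_rpow_neg_atTop hδ).comp tendsto_natCast_atTop_atTop).congr' ?_
  filter_upwards [eventually_gt_atTop 0] with x hx
  have hx₀ : (0 : ℝ) < x := mod_cast hx
  rw [Function.comp_apply, ← rpow_neg_one, ← rpow_add hx₀]
  congr 1
  ring

lemma tendsto_div_primeCounting (hf : PowerSaving f) :
    Tendsto (fun x ↦ f x / (Nat.primeCounting x : ℝ)) atTop (𝓝 0) := by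
  have hlim : Tendsto (fun x : ℕ ↦ 2 * ‖log x * f x / (x : ℝ)‖) atTop (𝓝 0) := by
    simpa only [norm_zero, mul_zero] using hf.log_mul.tendsto_div_natCast.norm.const_mul 2
  refine squeeze_zero_norm' ?_ hlim
  filter_upwards [eventually_le_two_mul_primeCounting_mul_log, eventually_gt_atTop 0] with x hx hx₀
  have hx₀ : (0 : ℝ) < x := mod_cast hx₀
  have hlog := log_natCast_nonneg x
  have hπ : (0 : ℝ) < Nat.primeCounting x := by
    refine (Nat.cast_nonneg _).lt_of_ne fun h ↦ ?_
    rw [← h, zero_mul, mul_zero] at hx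
    exact hx.not_gt hx₀
  rw [norm_div, norm_div, norm_mul, norm_natCast, norm_natCast, norm_of_nonneg hlog,
    ← mul_div_assoc, div_le_div_iff₀ hπ hx₀]
  calc ‖f x‖ * x ≤ ‖f x‖ * (2 * (Nat.primeCounting x * log x)) := by gcongr
    _ = 2 * (log x * ‖f x‖) * Nat.primeCounting x := by ring

end PowerSaving

theorem tendsto_mean_rpowChar_nth_prime {c : ℝ} (hc₁ : 1 < c) (hc : ∀ m : ℕ, c ≠ m) {α : ℝ}
    (hα : α ≠ 0) :
    Tendsto (fun N : ℕ ↦ (∑ n ∈ range N, rpowChar α c (Nat.nth Nat.Prime n)) / N) atTop (𝓝 0) := by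
  rw [← tendsto_add_atTop_iff_nat 1, tendsto_zero_iff_norm_tendsto_zero]
  have hinf := Nat.infinite_setOfPred_prime
  refine ((powerSaving_sum_prime_rpowChar hc₁ hc hα).tendsto_div_primeCounting.comp
    (Nat.nth_strictMono hinf).tendsto_atTop).congr fun N ↦ ?_
  have hcount : Nat.primeCounting (Nat.nth Nat.Prime N) = N + 1 :=
    Nat.count_nth_succ_of_infinite hinf N
  rw [Function.comp_apply, ← sum_range_primeCounting_nth, hcount, norm_div, Complex.norm_natCast]

/-! ### Equidistribution in residue classes -/

section WeakConvergence

open MeasureTheory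

variable {X : Type*} [TopologicalSpace X] [CompactSpace X] [MeasurableSpace X]
  [OpensMeasurableSpace X]

lemma integrable_continuousMap (μ : Measure X) [IsFiniteMeasure μ] (f : C(X, ℂ)) :
    Integrable f μ :=
  (BoundedContinuousFunction.mkOfCompact f).integrable μ

lemma lipschitzWith_integral_continuousMap (μ : ProbabilityMeasure X) :
    LipschitzWith 1 fun f : C(X, ℂ) ↦ ∫ t, f t ∂(μ : Measure X) := by
  refine LipschitzWith.of_dist_le_mul fun f g ↦ ?_
  rw [NNReal.coe_one, one_mul, dist_eq_norm, dist_eq_norm,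
    ← integral_sub (integrable_continuousMap _ f) (integrable_continuousMap _ g)]
  simpa only [probReal_univ, mul_one, ContinuousMap.sub_apply] using
    norm_integral_le_of_norm_le_const (μ := (μ : Measure X)) (ae_of_all _ (f - g).norm_coe_le_norm)

theorem tendsto_probabilityMeasure_of_span_dense {ι : Type*} {l : Filter ι}
    {μs : ι → ProbabilityMeasure X} {μ : ProbabilityMeasure X} {S : Set C(X, ℂ)}
    (hS : (Submodule.span ℂ S).topologicalClosure = ⊤)
    (h : ∀ f ∈ S, Tendsto (fun i ↦ ∫ t, f t ∂(μs i : Measure X)) l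
      (𝓝 (∫ t, f t ∂(μ : Measure X)))) :
    Tendsto μs l (𝓝 μ) := by
  set G : Set C(X, ℂ) :=
    {f | Tendsto (fun i ↦ ∫ t, f t ∂(μs i : Measure X)) l (𝓝 (∫ t, f t ∂(μ : Measure X)))}
  have hclosed : IsClosed G :=
    (LipschitzWith.uniformEquicontinuous _ 1 fun i ↦ lipschitzWith_integral_continuousMap
      (μs i)).equicontinuous.isClosed_setOfPred_tendsto
      (lipschitzWith_integral_continuousMap μ).continuous
  have hspan : (Submodule.span ℂ S : Set C(X, ℂ)) ⊆ G := by
    intro f hf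
    induction hf using Submodule.span_induction with
    | mem f hf => exact h f hf
    | zero => simpa [G] using tendsto_const_nhds
    | add f g _ _ hf hg =>
      simpa only [G, Set.mem_ofPred_eq, ContinuousMap.add_apply,
        integral_add (integrable_continuousMap _ f) (integrable_continuousMap _ g)]
        using Tendsto.add hf hg
    | smul a f _ hf =>
      simpa only [G, Set.mem_ofPred_eq, ContinuousMap.smul_apply, smul_eq_mul,
        integral_const_mul] using Tendsto.const_mul a hf
  refine (ProbabilityMeasure.tendsto_iff_forall_integral_rclike_tendsto ℂ).2 fun f ↦ ?_
  have hf : f.toContinuousMap ∈ (Submodule.span ℂ S).topologicalClosure := hS ▸ trivial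
  exact closure_minimal hspan hclosed hf

end WeakConvergence

/-- The proportion of the `n < N` with the property `P`; it is `0` for `N = 0`. Its limit as
`N → ∞` is the asymptotic density of `P`. -/
noncomputable def proportion (P : ℕ → Prop) (N : ℕ) : ℝ :=
  ({n | n < N ∧ P n}.ncard : ℝ) / N

lemma proportion_eq (P : ℕ → Prop) [DecidablePred P] (N : ℕ) :
    proportion P N = (#{n ∈ range N | P n} : ℝ) / N := by
  rw [proportion, ← Set.ncard_coe_finset]
  congr 3
  ext n
  simp

lemma proportion_mono {P Q : ℕ → Prop} (h : ∀ n, P n → Q n) (N : ℕ) :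
    proportion P N ≤ proportion Q N := by
  classical
  rw [proportion_eq, proportion_eq]
  gcongr with n
  exact h n

lemma proportion_le_add {P Q R : ℕ → Prop} (h : ∀ n, P n → Q n ∨ R n) (N : ℕ) :
    proportion P N ≤ proportion Q N + proportion R N := by
  classical
  rw [proportion_eq, proportion_eq, proportion_eq, ← add_div]
  gcongr
  norm_cast
  refine (card_le_card ?_).trans (card_union_le _ _)
  rw [← filter_or]
  exact monotone_filter_right _ fun n _ ↦ h n

lemma abs_proportion_sub_le {P Q R : ℕ → Prop} (h : ∀ n, ¬R n → (P n ↔ Q n)) (N : ℕ) :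
    |proportion P N - proportion Q N| ≤ proportion R N := by
  have hPQ := proportion_le_add (P := P) (Q := Q) (R := R)
    (fun n hn ↦ or_iff_not_imp_right.2 fun hR ↦ (h n hR).1 hn) N
  have hQP := proportion_le_add (P := Q) (Q := P) (R := R)
    (fun n hn ↦ or_iff_not_imp_right.2 fun hR ↦ (h n hR).2 hn) N
  rw [abs_sub_le_iff]
  constructor <;> linarith

section Weyl

open MeasureTheory

open scoped ENNReal

variable {X : Type*} [MeasurableSpace X]

/-- The uniform probability measure on the first `N` terms of a sequence, counted with multiplicity;
it is the zero measure for `N = 0`. -/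
noncomputable def empiricalMeasure (x : ℕ → X) (N : ℕ) : Measure X :=
  (N : ℝ≥0∞)⁻¹ • ∑ n ∈ range N, Measure.dirac (x n)

instance (x : ℕ → X) (N : ℕ) [NeZero N] : IsProbabilityMeasure (empiricalMeasure x N) where
  measure_univ := by
    simpa [empiricalMeasure] using
      ENNReal.inv_mul_cancel (Nat.cast_ne_zero.2 (NeZero.ne N)) (ENNReal.natCast_ne_top N)

instance : IsProbabilityMeasure (volume : Measure UnitAddCircle) :=
  ⟨UnitAddCircle.measure_univ⟩

variable [MeasurableSingletonClass X]

lemma integral_empiricalMeasure (x : ℕ → X) (N : ℕ) (f : X → ℂ) :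
    ∫ t, f t ∂(empiricalMeasure x N) = (∑ n ∈ range N, f (x n)) / N := by
  rw [empiricalMeasure, integral_smul_measure,
    integral_finsetSum_measure fun n _ ↦ integrable_dirac enorm_lt_top]
  simp [div_eq_inv_mul]

lemma empiricalMeasure_real_apply (x : ℕ → X) (N : ℕ) (s : Set X) :
    (empiricalMeasure x N).real s = proportion (fun n ↦ x n ∈ s) N := by
  classical
  rw [proportion_eq, empiricalMeasure, measureReal_ennreal_smul_apply, measureReal_def]
  simp [Set.indicator_apply, div_eq_inv_mul]

/-- The hypothesis of Weyl's criterion for the sequence `x` modulo `1`. -/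
def WeylSumsVanish (x : ℕ → ℝ) : Prop :=
  ∀ m : ℤ, m ≠ 0 → Tendsto (fun N : ℕ ↦ (∑ n ∈ range N, (𝐞 (m * x n) : ℂ)) / N) atTop (𝓝 0)

lemma fourier_coe_eq_fourierChar (m : ℤ) (x : ℝ) :
    fourier m (x : UnitAddCircle) = (𝐞 (m * x) : ℂ) := by
  rw [fourier_coe_apply, fourierChar_apply]
  congr 1
  push_cast
  ring

namespace WeylSumsVanish

variable {x : ℕ → ℝ}

lemma tendsto_integral_fourier (hx : WeylSumsVanish x) (m : ℤ) :
    Tendsto (fun N ↦ ∫ t, fourier m t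
      ∂(empiricalMeasure (fun n ↦ (x n : UnitAddCircle)) (N + 1))) atTop
      (𝓝 (∫ t : UnitAddCircle, fourier m t)) := by
  rcases eq_or_ne m 0 with rfl | hm
  · simp
  · have hzero : ∫ t : UnitAddCircle, fourier m t = 0 :=
      integral_eq_zero_of_add_right_eq_neg (fourier_add_half_inv_index hm one_pos)
    simpa only [hzero, integral_empiricalMeasure, fourier_coe_eq_fourierChar] using
      (tendsto_add_atTop_iff_nat 1).2 (hx m hm)

theorem tendsto_proportion (hx : WeylSumsVanish x) {s : Set UnitAddCircle}
    (hs : volume (frontier s) = 0) :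
    Tendsto (proportion fun n ↦ (x n : UnitAddCircle) ∈ s) atTop (𝓝 (volume.real s)) := by
  rw [← tendsto_add_atTop_iff_nat 1]
  let μs (N : ℕ) : ProbabilityMeasure UnitAddCircle :=
    ⟨empiricalMeasure (fun n ↦ (x n : UnitAddCircle)) (N + 1), inferInstance⟩
  let μ : ProbabilityMeasure UnitAddCircle := ⟨volume, inferInstance⟩
  have hμs : Tendsto μs atTop (𝓝 μ) := by
    refine tendsto_probabilityMeasure_of_span_dense span_fourier_closure_eq_top ?_
    rintro _ ⟨m, rfl⟩
    exact hx.tendsto_integral_fourier m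
  have hmeasure := ProbabilityMeasure.tendsto_measure_of_null_frontier_of_tendsto' hμs hs
  exact ((ENNReal.tendsto_toReal (measure_ne_top volume s)).comp hmeasure).congr fun N ↦
    empiricalMeasure_real_apply _ _ _

end WeylSumsVanish

lemma volume_sphere_unitAddCircle (t : UnitAddCircle) (ε : ℝ) :
    volume (Metric.sphere t ε) = 0 := by
  rw [← Metric.closedBall_sdiff_ball]
  exact ae_le_set.1 AddCircle.closedBall_ae_eq_ball.le

lemma volume_real_closedBall_unitAddCircle (t : UnitAddCircle) {ε : ℝ} (hε₀ : 0 ≤ ε)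
    (hε : 2 * ε ≤ 1) : volume.real (Metric.closedBall t ε) = 2 * ε := by
  rw [measureReal_def, AddCircle.volume_closedBall, min_eq_right hε,
    ENNReal.toReal_ofReal (by linarith)]

namespace WeylSumsVanish

variable {x : ℕ → ℝ}

theorem tendsto_proportion_of_ball_of_closedBall (hx : WeylSumsVanish x) {P : ℕ → Prop}
    {t : UnitAddCircle} {ε : ℝ} (hε₀ : 0 ≤ ε) (hε : 2 * ε ≤ 1)
    (hball : ∀ n, (x n : UnitAddCircle) ∈ Metric.ball t ε → P n)
    (hclosedBall : ∀ n, P n → (x n : UnitAddCircle) ∈ Metric.closedBall t ε) :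
    Tendsto (proportion P) atTop (𝓝 (2 * ε)) := by
  have hlower := hx.tendsto_proportion
    (measure_mono_null Metric.frontier_ball_subset_sphere (volume_sphere_unitAddCircle t ε))
  have hupper := hx.tendsto_proportion
    (measure_mono_null Metric.frontier_closedBall_subset_sphere (volume_sphere_unitAddCircle t ε))
  rw [measureReal_congr AddCircle.closedBall_ae_eq_ball.symm,
    volume_real_closedBall_unitAddCircle t hε₀ hε] at hlower
  rw [volume_real_closedBall_unitAddCircle t hε₀ hε] at hupper
  exact tendsto_of_tendsto_of_tendsto_of_le_of_le hlower hupper (proportion_mono hball)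
    (proportion_mono hclosedBall)

end WeylSumsVanish

end Weyl

/-- Every residue class modulo `q` contains the expected proportion `1 / q` of the terms of `b`, for
every `q > 0`. -/
def EquidistributedMod (b : ℕ → ℕ) : Prop :=
  ∀ q > 0, ∀ r < q, HasFrequency (fun n ↦ b n % q) r (1 / q : ℝ)

lemma floor_mod_eq_of_mem_ball {q r : ℕ} (hr : r < q) {y : ℝ} (hy : 0 ≤ y)
    (h : ((y / q : ℝ) : UnitAddCircle) ∈
      Metric.ball (((r + 1 / 2) / q : ℝ) : UnitAddCircle) (1 / (2 * q))) : ⌊y⌋₊ % q = r := by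
  have hq : (0 : ℝ) < q := mod_cast (Nat.zero_le r).trans_lt hr
  rw [Metric.mem_ball, dist_eq_norm, ← AddCircle.coe_sub, UnitAddCircle.norm_eq] at h
  set m := round (y / q - (r + 1 / 2) / q)
  have hscale : y / q - (r + 1 / 2) / q - m = (y - (r + q * m) - 1 / 2) / q := by
    field_simp
    ring
  rw [hscale, abs_div, abs_of_pos hq, ← div_div, div_lt_div_iff_of_pos_right hq, abs_lt] at h
  have hfloor : ⌊y⌋ = r + q * m := by
    rw [Int.floor_eq_iff]
    push_cast
    constructor <;> linarith
  have hmod : ((⌊y⌋₊ % q : ℕ) : ℤ) = r := by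
    rw [Int.natCast_mod, Int.natCast_floor_eq_floor hy, hfloor, Int.add_mul_emod_self_left]
    exact Int.emod_eq_of_lt (by omega) (by omega)
  exact_mod_cast hmod

lemma mem_closedBall_of_floor_mod_eq {q : ℕ} (hq : 0 < q) {y : ℝ} (hy : 0 ≤ y) :
    ((y / q : ℝ) : UnitAddCircle) ∈ Metric.closedBall
      ((((⌊y⌋₊ % q : ℕ) + 1 / 2) / q : ℝ) : UnitAddCircle) (1 / (2 * q)) := by
  have hq₀ : (0 : ℝ) < q := mod_cast hq
  rw [Metric.mem_closedBall, dist_eq_norm, ← AddCircle.coe_sub, UnitAddCircle.norm_eq]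
  refine (round_le _ (⌊y⌋₊ / q : ℕ)).trans ?_
  have hdivMod : (q * (⌊y⌋₊ / q : ℕ) + (⌊y⌋₊ % q : ℕ) : ℝ) = ⌊y⌋₊ :=
    mod_cast Nat.div_add_mod ⌊y⌋₊ q
  have hscale : y / q - ((⌊y⌋₊ % q : ℕ) + 1 / 2) / q - (⌊y⌋₊ / q : ℕ) =
      (y - ⌊y⌋₊ - 1 / 2) / q := by
    rw [← hdivMod]
    field_simp
    ring
  rw [Int.cast_natCast, hscale, abs_div, abs_of_pos hq₀, ← div_div,
    div_le_div_iff_of_pos_right hq₀, abs_le]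
  constructor <;> linarith [Nat.floor_le hy, Nat.lt_floor_add_one y]

theorem equidistributedMod_floor_of_weylSumsVanish {y : ℕ → ℝ} (hy₀ : ∀ n, 0 ≤ y n)
    (hy : ∀ q : ℕ, 0 < q → WeylSumsVanish fun n ↦ y n / q) :
    EquidistributedMod fun n ↦ ⌊y n⌋₊ := by
  intro q hq r hr
  have hq₁ : (1 : ℝ) ≤ q := mod_cast hq
  have hfreq := (hy q hq).tendsto_proportion_of_ball_of_closedBall
    (P := fun n ↦ ⌊y n⌋₊ % q = r) (t := (((r + 1 / 2) / q : ℝ) : UnitAddCircle))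
    (ε := 1 / (2 * q)) (by positivity) (by field_simp; exact hq₁)
    (fun n ↦ floor_mod_eq_of_mem_ball hr (hy₀ n))
    (fun n hn ↦ hn ▸ mem_closedBall_of_floor_mod_eq hq (hy₀ n))
  rwa [← div_div, mul_div_assoc', mul_one_div_cancel two_ne_zero] at hfreq

theorem equidistributedMod_floor_nth_prime_rpow {c : ℝ} (hc₁ : 1 < c) (hc : ∀ m : ℕ, c ≠ m) :
    EquidistributedMod fun n ↦ ⌊(Nat.nth Nat.Prime n : ℝ) ^ c⌋₊ := by
  refine equidistributedMod_floor_of_weylSumsVanish (fun n ↦ by positivity) fun q hq m hm ↦ ?_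
  have hα : (m / q : ℝ) ≠ 0 := div_ne_zero (mod_cast hm) (mod_cast hq.ne')
  refine (tendsto_mean_rpowChar_nth_prime hc₁ hc hα).congr fun N ↦ ?_
  simp only [rpowChar, div_mul_eq_mul_div, mul_div_assoc]

lemma abs_count_mod_eq_sub_le {q r : ℕ} (hr : r < q) (N : ℕ) :
    |(Nat.count (· % q = r) N : ℝ) - N / q| ≤ 1 := by
  have hq : 0 < q := (Nat.zero_le r).trans_lt hr
  have hq₀ : (0 : ℝ) < q := mod_cast hq
  have hcount : Nat.count (· % q = r) N = N / q + if r < N % q then 1 else 0 := by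
    simpa only [Nat.ModEq, Nat.mod_eq_of_lt hr] using Nat.count_modEq_card N hq r
  have hfloor : ((N / q : ℕ) : ℝ) = ⌊(N / q : ℝ)⌋₊ := by rw [Nat.floor_div_eq_div]
  have hle := Nat.floor_le (div_nonneg N.cast_nonneg hq₀.le : (0 : ℝ) ≤ N / q)
  have hlt := Nat.lt_floor_add_one (N / q : ℝ)
  rw [hcount, Nat.cast_add, hfloor, abs_le]
  split_ifs <;> push_cast <;> constructor <;> linarith

theorem equidistributedMod_id : EquidistributedMod fun n ↦ n := by
  intro q _ r hr
  refine tendsto_iff_norm_sub_tendsto_zero.2 (squeeze_zero_norm' ?_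
    tendsto_one_div_atTop_nhds_zero_nat)
  filter_upwards [eventually_gt_atTop 0] with N hN
  have hN₀ : (0 : ℝ) < N := mod_cast hN
  change ‖‖proportion (fun n ↦ n % q = r) N - 1 / q‖‖ ≤ 1 / N
  rw [norm_norm, proportion_eq, ← Nat.count_eq_card_filter_range, norm_eq_abs, le_div_iff₀ hN₀,
    ← abs_of_pos hN₀, ← abs_mul, abs_of_pos hN₀, sub_mul, div_mul_cancel₀ _ hN₀.ne',
    one_div_mul_eq_div]
  exact abs_count_mod_eq_sub_le hr N

theorem EquidistributedMod.tendsto_proportion {b : ℕ → ℕ} (hb : EquidistributedMod b) {q : ℕ}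
    (hq : 0 < q) (P : ℕ → Prop) [DecidablePred P] :
    Tendsto (proportion fun n ↦ P (b n % q)) atTop (𝓝 (#{r ∈ range q | P r} / q)) := by
  have hsum : Tendsto (fun N ↦ ∑ r ∈ range q with P r, proportion (fun n ↦ b n % q = r) N) atTop
      (𝓝 (∑ r ∈ range q with P r, (1 / q : ℝ))) :=
    tendsto_finsetSum _ fun r hr ↦ hb q hq r (mem_range.1 (mem_filter.1 hr).1)
  rw [sum_const, nsmul_eq_mul, mul_one_div] at hsum
  refine hsum.congr fun N ↦ ?_
  classical
  simp only [proportion_eq]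
  rw [← sum_div, ← Nat.cast_sum, card_eq_sum_card_fiberwise (f := fun n ↦ b n % q)
    (t := {r ∈ range q | P r})]
  · congr 2
    refine sum_congr rfl fun r hr ↦ ?_
    rw [filter_filter]
    congr 1
    refine filter_congr fun n _ ↦ ⟨fun h ↦ ⟨h ▸ (mem_filter.1 hr).2, h⟩, And.right⟩
  · intro n hn
    simp_all [Nat.mod_lt]

lemma exists_forall_tendsto_of_approx {ι β E : Type*} [Nonempty ι] [PseudoMetricSpace E]
    [CompleteSpace E] {l : Filter β} [l.NeBot] {x : ι → β → E}
    (h : ∀ ε > 0, ∃ v, ∀ i, ∀ᶠ N in l, dist (x i N) v ≤ ε) :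
    ∃ y, ∀ i, Tendsto (x i) l (𝓝 y) := by
  have hcauchy : Cauchy (⨆ i, map (x i) l) := by
    refine Metric.cauchy_iff.2 ⟨iSup_neBot.2 ⟨Classical.arbitrary ι, inferInstance⟩, fun ε hε ↦ ?_⟩
    obtain ⟨v, hv⟩ := h (ε / 3) (by positivity)
    refine ⟨Metric.closedBall v (ε / 3), mem_iSup.2 hv, fun y hy z hz ↦ ?_⟩
    linarith [dist_triangle_right y z v, Metric.mem_closedBall.1 hy, Metric.mem_closedBall.1 hz]
  obtain ⟨y, hy⟩ := CompleteSpace.complete hcauchy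
  exact ⟨y, iSup_le_iff.1 hy⟩

/-! ### Synchronizing automata -/

lemma digits_div_pow_isSuffix {k : ℕ} (hk : 2 ≤ k) (n L : ℕ) :
    Nat.digits k (n / k ^ L) <:+ Nat.digits k n := by
  induction L generalizing n with
  | zero => simp
  | succ L ih =>
    rcases eq_or_ne n 0 with rfl | hn
    · simp
    rw [pow_succ', ← Nat.div_div_eq_div_mul, Nat.digits_eq_cons_digits_div hk hn]
    exact (ih _).trans (List.suffix_cons _ _)

lemma digits_mod_pow_isPrefix {k : ℕ} (hk : 2 ≤ k) (n L : ℕ) :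
    Nat.digits k (n % k ^ L) <+: Nat.digits k n := by
  induction L generalizing n with
  | zero => simp [Nat.mod_one]
  | succ L ih =>
    rcases eq_or_ne (n % k ^ (L + 1)) 0 with h₀ | h₀
    · simp [h₀]
    have hn : n ≠ 0 := by rintro rfl; exact h₀ (Nat.zero_mod _)
    rw [Nat.digits_eq_cons_digits_div hk h₀, Nat.digits_eq_cons_digits_div hk hn,
      Nat.mod_mod_of_dvd _ (dvd_pow_self k L.succ_ne_zero), pow_succ', Nat.mod_mul_right_div_self]
    exact List.cons_prefix_cons.2 ⟨rfl, ih _⟩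

lemma map_val_baseExpansion {k : ℕ} (hk : 2 ≤ k) (n : ℕ) :
    (baseExpansion k hk n).map Fin.val = (Nat.digits k n).reverse := by
  simp [baseExpansion, List.map_pmap]

lemma baseExpansion_div_pow_isPrefix {k : ℕ} (hk : 2 ≤ k) (n L : ℕ) :
    baseExpansion k hk (n / k ^ L) <+: baseExpansion k hk n := by
  rw [← List.prefix_map_iff_of_injective Fin.val_injective, map_val_baseExpansion,
    map_val_baseExpansion, List.reverse_prefix]
  exact digits_div_pow_isSuffix hk n L

lemma baseExpansion_mod_pow_isSuffix {k : ℕ} (hk : 2 ≤ k) (n L : ℕ) :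
    baseExpansion k hk (n % k ^ L) <:+ baseExpansion k hk n := by
  rw [← List.suffix_map_iff_of_injective Fin.val_injective, map_val_baseExpansion,
    map_val_baseExpansion, List.reverse_suffix]
  exact digits_mod_pow_isPrefix hk n L

/- Prepending the digit `1` protects the leading zeros of `w`. -/
lemma exists_isSuffix_baseExpansion {k : ℕ} (hk : 2 ≤ k) (w : List (Fin k)) :
    ∃ v, w <:+ baseExpansion k hk v := by
  have hdigits : Nat.digits k (Nat.ofDigits k (1 :: w.map Fin.val).reverse) =
      (1 :: w.map Fin.val).reverse := by
    refine Nat.digits_ofDigits k hk _ (fun d hd ↦ ?_) (by simp)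
    rcases List.mem_cons.1 (List.mem_reverse.1 hd) with rfl | hd
    · exact hk
    · obtain ⟨i, -, rfl⟩ := List.mem_map.1 hd
      exact i.isLt
  refine ⟨Nat.ofDigits k (1 :: w.map Fin.val).reverse, ?_⟩
  rw [← List.suffix_map_iff_of_injective Fin.val_injective, map_val_baseExpansion, hdigits,
    List.reverse_reverse]
  exact List.suffix_cons _ _

end PrimePowerSums

namespace OutputAutomaton

open Finset PrimePowerSums

variable {k : ℕ} {σ : Type} {A : Type*} {M : OutputAutomaton k σ A}

lemma run_append (s : σ) (u v : List (Fin k)) : M.run s (u ++ v) = M.run (M.run s u) v :=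
  List.foldl_append

namespace IsSynchronizingWord

variable {u w : List (Fin k)}

lemma run_eq_run (hu : M.IsSynchronizingWord u) (s t : σ) : M.run s u = M.run t u := by
  obtain ⟨s₀, hs₀⟩ := hu
  rw [hs₀, hs₀]

lemma of_isInfix (hu : M.IsSynchronizingWord u) (huw : u <:+: w) : M.IsSynchronizingWord w := by
  obtain ⟨s₀, hs₀⟩ := hu
  obtain ⟨x, y, rfl⟩ := huw
  exact ⟨M.run s₀ y, fun t ↦ by rw [run_append, run_append, hs₀]⟩

lemma run_eq_of_isSuffix (hu : M.IsSynchronizingWord u) (huw : u <:+ w) (s : σ) :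
    M.run s w = M.run s u := by
  obtain ⟨x, rfl⟩ := huw
  rw [run_append, hu.run_eq_run]

end IsSynchronizingWord

lemma Generates.apply_mod_pow {hk : 2 ≤ k} {a : ℕ → A} (hM : M.Generates hk a) {n L : ℕ}
    (h : M.IsSynchronizingWord (baseExpansion k hk (n % k ^ L))) : a (n % k ^ L) = a n := by
  rw [hM, hM, h.run_eq_of_isSuffix (baseExpansion_mod_pow_isSuffix hk n L)]

/- A number below `Q ^ t`, `Q = k ^ ℓ`, one of whose base-`Q` digits is `v` has an expansion that
contains the synchronizing expansion of `v`. -/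
open Classical in
lemma card_filter_not_isSynchronizingWord_le {hk : 2 ≤ k} {v ℓ : ℕ} (hv : v < k ^ ℓ)
    (hsync : M.IsSynchronizingWord (baseExpansion k hk v)) (t : ℕ) :
    #{r ∈ range ((k ^ ℓ) ^ t) | ¬M.IsSynchronizingWord (baseExpansion k hk r)} ≤
      (k ^ ℓ - 1) ^ t := by
  induction t with
  | zero => exact (card_filter_le _ _).trans_eq (by simp)
  | succ t ih =>
    set Q := k ^ ℓ
    set F := {r ∈ range (Q ^ t) | ¬M.IsSynchronizingWord (baseExpansion k hk r)}
    have hcard : #(F ×ˢ (range Q).erase v) ≤ (Q - 1) ^ (t + 1) := by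
      rw [card_product, card_erase_of_mem (mem_range.2 hv), card_range, pow_succ]
      exact Nat.mul_le_mul_right _ ih
    refine (card_le_card_of_injOn (fun r ↦ (r / Q, r % Q)) (fun r hr ↦ ?_) ?_).trans hcard
    · obtain ⟨hrQ, hr⟩ := mem_filter.1 hr
      have hdiv : ¬M.IsSynchronizingWord (baseExpansion k hk (r / Q)) := fun h ↦
        hr (h.of_isInfix (baseExpansion_div_pow_isPrefix hk r ℓ).isInfix)
      have hmod : r % Q ≠ v := by
        rintro rfl
        exact hr (hsync.of_isInfix (baseExpansion_mod_pow_isSuffix hk r ℓ).isInfix)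
      have hlt : r / Q < Q ^ t := Nat.div_lt_of_lt_mul (by rwa [mem_range, pow_succ'] at hrQ)
      simp only [mem_coe, mem_product, mem_erase, mem_range]
      exact ⟨mem_filter.2 ⟨mem_range.2 hlt, hdiv⟩, hmod, Nat.mod_lt _ (Nat.zero_lt_of_lt hv)⟩
    · intro r _ s _ hrs
      obtain ⟨hdiv, hmod⟩ := Prod.mk.inj hrs
      rw [← Nat.div_add_mod r Q, ← Nat.div_add_mod s Q, hdiv, hmod]

open Classical in
lemma exists_card_filter_not_isSynchronizingWord_lt (hk : 2 ≤ k) {w : List (Fin k)}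
    (hw : M.IsSynchronizingWord w) {ε : ℝ} (hε : 0 < ε) :
    ∃ L : ℕ, (#{r ∈ range (k ^ L) | ¬M.IsSynchronizingWord (baseExpansion k hk r)} : ℝ) /
      (k ^ L : ℕ) < ε := by
  obtain ⟨v, hwv⟩ := exists_isSuffix_baseExpansion hk w
  have hv : v < k ^ v := Nat.lt_pow_self hk
  have hQ : (0 : ℝ) < (k ^ v : ℕ) := mod_cast (Nat.zero_le v).trans_lt hv
  have hratio : (((k ^ v : ℕ) : ℝ) - 1) / (k ^ v : ℕ) < 1 := by
    rw [div_lt_one hQ]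
    linarith
  obtain ⟨t, ht⟩ := exists_pow_lt_of_lt_one hε hratio
  refine ⟨v * t, lt_of_le_of_lt ?_ ht⟩
  rw [pow_mul, div_pow, Nat.cast_pow (k ^ v), ← Nat.cast_pred (mod_cast hQ)]
  gcongr
  exact mod_cast card_filter_not_isSynchronizingWord_le hv (hw.of_isInfix hwv.isInfix) t

theorem Generates.exists_forall_hasFrequency {hk : 2 ≤ k} {a : ℕ → A} (hM : M.Generates hk a)
    {w : List (Fin k)} (hw : M.IsSynchronizingWord w) (α : A) :
    ∃ ϑ, ∀ b : ℕ → ℕ, EquidistributedMod b → HasFrequency (fun n ↦ a (b n)) α ϑ := by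
  classical
  have : Nonempty {b : ℕ → ℕ // EquidistributedMod b} := ⟨⟨_, equidistributedMod_id⟩⟩
  suffices h : ∀ ε > 0, ∃ v, ∀ b : {b : ℕ → ℕ // EquidistributedMod b},
      ∀ᶠ N in atTop, dist (proportion (fun n ↦ a (b.1 n) = α) N) v ≤ ε by
    obtain ⟨ϑ, hϑ⟩ := exists_forall_tendsto_of_approx h
    exact ⟨ϑ, fun b hb ↦ hϑ ⟨b, hb⟩⟩
  intro ε hε
  obtain ⟨L, hL⟩ := exists_card_filter_not_isSynchronizingWord_lt hk hw (half_pos hε)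
  have hq : 0 < k ^ L := by positivity
  refine ⟨#{r ∈ range (k ^ L) | a r = α} / (k ^ L : ℕ), fun ⟨b, hb⟩ ↦ ?_⟩
  have hmain := hb.tendsto_proportion hq (a · = α)
  have hexcept := hb.tendsto_proportion hq fun r ↦ ¬M.IsSynchronizingWord (baseExpansion k hk r)
  filter_upwards [Metric.tendsto_nhds.1 hmain _ (half_pos hε), hexcept.eventually_lt_const hL]
    with N hN hNexcept
  have hreplace : |proportion (fun n ↦ a (b n) = α) N -
      proportion (fun n ↦ a (b n % k ^ L) = α) N| ≤
      proportion (fun n ↦ ¬M.IsSynchronizingWord (baseExpansion k hk (b n % k ^ L))) N :=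
    abs_proportion_sub_le (fun n hn ↦ by rw [hM.apply_mod_pow (not_not.1 hn)]) N
  rw [← Real.dist_eq] at hreplace
  linarith [dist_triangle (proportion (fun n ↦ a (b n) = α) N)
    (proportion (fun n ↦ a (b n % k ^ L) = α) N) (#{r ∈ range (k ^ L) | a r = α} / (k ^ L : ℕ))]

end OutputAutomaton

theorem mainTheorem5_general {k : ℕ} (hk : 2 ≤ k) {A : Type*} {a : ℕ → A} {σ : Type}
    {M : OutputAutomaton k σ A} (hM : M.Generates hk a) {w : List (Fin k)}
    (hw : M.IsSynchronizingWord w) {c : ℝ} (hc₁ : 1 < c) (hc : ∀ m : ℤ, c ≠ m) (α : A) :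
    ∃ ϑ : ℝ, HasFrequency a α ϑ ∧
      HasFrequency (fun n : ℕ ↦ a ⌊(Nat.nth Nat.Prime n : ℝ) ^ c⌋₊) α ϑ := by
  obtain ⟨ϑ, hϑ⟩ := hM.exists_forall_hasFrequency hw α
  exact ⟨ϑ, hϑ _ PrimePowerSums.equidistributedMod_id,
    hϑ _ (PrimePowerSums.equidistributedMod_floor_nth_prime_rpow hc₁ fun m ↦ mod_cast hc m)⟩

theorem mainTheorem5 {A : Type*} (k : ℕ) (hk : 2 ≤ k) (a : ℕ → A)
    (ha : IsSynchronizingAutomatic k hk a)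
    (c : ℝ) (hc : 1 < c) (hcint : ∀ m : ℤ, c ≠ (m : ℝ)) (α : A) :
    ∃ ϑ : ℝ, HasFrequency a α ϑ ∧
      HasFrequency (fun n : ℕ => a ⌊((Nat.nth Nat.Prime n : ℕ) : ℝ) ^ c⌋₊) α ϑ := by
  obtain ⟨σ, _, M, hM, w, hw⟩ := ha
  exact mainTheorem5_general hk hM hw hc hcint α
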